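/- Let $\mathbf{Y}=\langle\mathcal P,\le\rangle$ be Young's lattice: $\mathcal P$ is the set of all integer partitions (including the empty partition), and $\sigma\le\pi$ means that the Young diagram of $\sigma$ is contained in the Young diagram of $\pi$. Let $\mathrm{Th}(\mathbf Y)$ be its elementary theory, that is, the set of all first-order sentences (with equality) in the language with a single binary relation symbol $\le$ that are true in $\mathbf Y$. Then: 1. $\mathrm{Th}(\mathbf Y)$ is undecidable: under a standard Gödel numbering of the sentences of this language, the set of Gödel numbers of the sentences in $\mathrm{Th}(\mathbf Y)$ is not recursive. 2. $\mathrm{Th}(\mathbf Y)$ is inherently non-finitely axiomatizable: $\mathrm{Th}(\mathbf Y)$ is not finitely axiomatizable, and no consistent first-order theory extending it, whether in the same language or in a larger one, is finitely axiomatizable. Here a theory $T$ is finitely axiomatizable if there is a finite set of sentences in the language of $T$ having the same logical consequences as $T$. -/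

import Mathlib

universe u v u' v'

open FirstOrder

namespace YoungLattice

/-- Young's lattice as a first-order structure in the language with the single binary relation
symbol `≤`: the elements are all Young diagrams (including the empty one), and `≤` is
containment of diagrams. -/
instance structureYoungDiagram : Language.order.Structure YoungDiagram :=
  Language.orderStructure YoungDiagram

/-- The elementary theory of Young's lattice: all first-order sentences in the language of
ordered sets that are true in it. -/
def elementaryTheory : Language.order.Theory :=
  Language.order.completeTheory YoungDiagram

/-- A term without parameters in the language of orders is a bound variable; its code is the index
of that variable. -/
def termCode {n : ℕ} : Language.order.Term (Empty ⊕ Fin n) → ℕ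
  | .var (.inl e) => e.elim
  | .var (.inr i) => i
  | .func f _ => Empty.elim f

/-- The standard recursive Gödel numbering of the first-order formulas of the language of orders,
built from the Cantor-style pairing function `Nat.pair`. -/
def formulaCode : ∀ {n : ℕ}, Language.order.BoundedFormula Empty n → ℕ
  | _, .falsum => 0
  | _, .equal t s => 4 * Nat.pair (termCode t) (termCode s) + 1
  | _, .rel (l := 2) .le ts => 4 * Nat.pair (termCode (ts 0)) (termCode (ts 1)) + 2
  | _, .imp p q => 4 * Nat.pair (formulaCode p) (formulaCode q) + 3
  | _, .all p => 4 * formulaCode p + 4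

theorem termCode_injective {n : ℕ} :
    Function.Injective (termCode : Language.order.Term (Empty ⊕ Fin n) → ℕ) := by
  intro t s h
  match t, s, h with
  | .var (.inl e), _, _ => exact e.elim
  | .func f _, _, _ => exact Empty.elim f
  | .var (.inr _), .var (.inl e), _ => exact e.elim
  | .var (.inr _), .func f _, _ => exact Empty.elim f
  | .var (.inr i), .var (.inr j), h =>
    have : i = j := Fin.ext h
    rw [this]

/-- Distinct formulas with the same number of free variables, in particular distinct sentences,
have distinct codes. -/
theorem formulaCode_injective : ∀ {n : ℕ} (p q : Language.order.BoundedFormula Empty n),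
    formulaCode p = formulaCode q → p = q
  | _, .falsum, q, h => by
    match q, h with
    | .falsum, _ => rfl
    | .equal _ _, h => simp [formulaCode] at h
    | .rel (l := 2) .le _, h => simp [formulaCode] at h
    | .imp _ _, h => simp [formulaCode] at h
    | .all _, h => simp [formulaCode] at h
  | _, .equal t s, q, h => by
    match q, h with
    | .falsum, h => simp [formulaCode] at h
    | .equal t' s', h =>
      simp only [formulaCode] at h
      obtain ⟨h1, h2⟩ := Nat.pair_eq_pair.1 (show Nat.pair (termCode t) (termCode s) =
        Nat.pair (termCode t') (termCode s') by omega)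
      rw [termCode_injective h1, termCode_injective h2]
    | .rel (l := 2) .le _, h => simp only [formulaCode] at h; omega
    | .imp _ _, h => simp only [formulaCode] at h; omega
    | .all _, h => simp only [formulaCode] at h; omega
  | _, .rel (l := 2) .le ts, q, h => by
    match q, h with
    | .falsum, h => simp [formulaCode] at h
    | .equal _ _, h => simp only [formulaCode] at h; omega
    | .rel (l := 2) .le ts', h =>
      simp only [formulaCode] at h
      obtain ⟨h1, h2⟩ := Nat.pair_eq_pair.1 (show Nat.pair (termCode (ts 0)) (termCode (ts 1)) =
        Nat.pair (termCode (ts' 0)) (termCode (ts' 1)) by omega)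
      have : ts = ts' := by
        funext i
        match i with
        | 0 => exact termCode_injective h1
        | 1 => exact termCode_injective h2
      rw [this]
    | .imp _ _, h => simp only [formulaCode] at h; omega
    | .all _, h => simp only [formulaCode] at h; omega
  | _, .imp a b, q, h => by
    match q, h with
    | .falsum, h => simp [formulaCode] at h
    | .equal _ _, h => simp only [formulaCode] at h; omega
    | .rel (l := 2) .le _, h => simp only [formulaCode] at h; omega
    | .imp a' b', h =>
      simp only [formulaCode] at h
      obtain ⟨h1, h2⟩ := Nat.pair_eq_pair.1 (show Nat.pair (formulaCode a) (formulaCode b) =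
        Nat.pair (formulaCode a') (formulaCode b') by omega)
      rw [formulaCode_injective a a' h1, formulaCode_injective b b' h2]
    | .all _, h => simp only [formulaCode] at h; omega
  | _, .all a, q, h => by
    match q, h with
    | .falsum, h => simp [formulaCode] at h
    | .equal _ _, h => simp only [formulaCode] at h; omega
    | .rel (l := 2) .le _, h => simp only [formulaCode] at h; omega
    | .imp _ _, h => simp only [formulaCode] at h; omega
    | .all a', h =>
      simp only [formulaCode] at h
      rw [formulaCode_injective a a' (by omega)]

/-- A set of sentences in the language of orders is decidable if the set of Gödel numbers of its
members is recursive. -/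
def DecidableTheory (T : Language.order.Theory) : Prop :=
  ComputablePred fun k : ℕ => ∃ σ : Language.order.Sentence, σ ∈ T ∧ formulaCode σ = k

/-- A theory is finitely axiomatizable if some finite set of sentences of the same language has
exactly the same logical consequences. -/
def FinitelyAxiomatizable {L : FirstOrder.Language.{u, v}} (T : L.Theory) : Prop :=
  ∃ T₀ : L.Theory, T₀.Finite ∧ ∀ σ : L.Sentence, T₀ ⊨ᵇ σ ↔ T ⊨ᵇ σ

/-- A theory `T` is inherently non-finitely axiomatizable if neither `T` itself nor any consistent
extension of `T`, possibly in a larger language, is finitely axiomatizable. The larger language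
comes with a map `φ` naming the symbols of the language of `T` in it, and `T'` extends `T` if it
proves (the translation along `φ` of) every sentence of `T`. -/
def InherentlyNonFinitelyAxiomatizable {L : FirstOrder.Language.{u, v}} (T : L.Theory) : Prop :=
  ¬ FinitelyAxiomatizable T ∧
    ∀ (L' : FirstOrder.Language.{u', v'}) (φ : L →ᴸ L') (T' : L'.Theory), T'.IsSatisfiable →
      (∀ σ ∈ T, T' ⊨ᵇ φ.onSentence σ) → ¬ FinitelyAxiomatizable T'

end YoungLattice

-- The truth set of Young's lattice is not even recursively enumerable, because arithmetic is
-- definable in it; both claims follow from this.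
--
-- Definability uses one parameter, the row `rect 1 2`. The diagrams with a chain below them are the
-- rows and the columns, and comparability with the parameter separates the two (`isRow_iff`,
-- `isCol_iff`). The number n is named by the row of length n. A rectangle is the largest diagram
-- with bounded first row and first column, and staircases match rows with columns of the same
-- length (`col_eq_iff`), so the length of the i-th row is definable from i. Diagrams now act as
-- finite sequences: sum and product are read off diagrams whose row lengths decrease at a constant
-- rate, and any finite sequence is a sequence of differences of consecutive row lengths. This gives
-- primitive recursion directly (`mem_rec_iff`), and hence every recursively enumerable set is
-- definable (`def_of_rePred`), as is its complement.
--
-- The parameter is definable only up to transposition. Transposition is an automorphism, so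
-- quantifying the parameter away is harmless (`realize_instanceSentence`). Applied to the
-- complement of the halting problem, this computably turns codes of programs into sentences and
-- shows that truth is not recursively enumerable (`not_rePred_of_iff_mem_elementaryTheory`).
--
-- Suppose a consistent extension T, in any language, were finitely axiomatized, say by one sentence
-- τ. The elementary theory is complete, so a sentence of the order language would be true exactly
-- when τ entails it. Entailment from τ is recursively enumerable (`exists_rePred_iff_models`), a
-- contradiction. Instead of a proof calculus, the argument uses a Herbrand-style reduction: a model
-- of τ and ¬σ exists iff a primitive recursive family of propositional clauses, describing a term
-- model with Henkin witnesses, is satisfiable. By compactness, unsatisfiability shows up at a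
-- finite stage and can be found by search (`rePred_unsatisfiable`).

universe w

namespace YoungLattice

/-! ### Rectangular diagrams -/

/-- The rectangular Young diagram with `a` rows and `b` columns. -/
def rect (a b : ℕ) : YoungDiagram where
  cells := Finset.range a ×ˢ Finset.range b
  isLowerSet := by
    rintro ⟨i, j⟩ ⟨i', j'⟩ ⟨h1, h2⟩ h
    simp only [Finset.coe_product, Finset.coe_range, Set.mem_prod, Set.mem_Iio] at h ⊢
    dsimp only at h1 h2
    omega

theorem mem_rect {a b : ℕ} {c : ℕ × ℕ} : c ∈ rect a b ↔ c.1 < a ∧ c.2 < b := by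
  rw [← YoungDiagram.mem_cells]; simp [rect]

theorem le_iff_mem {μ ν : YoungDiagram} : μ ≤ ν ↔ ∀ i j, (i, j) ∈ μ → (i, j) ∈ ν :=
  ⟨fun h _ _ hc => h hc, fun h => fun ⟨i, j⟩ hc => h i j hc⟩

/-- A nonempty rectangle is the lower set generated by its corner cell. Single cells thereby become
accessible to formulas that mention only containment. -/
theorem rect_succ_le {a b : ℕ} {μ : YoungDiagram} : rect (a + 1) (b + 1) ≤ μ ↔ (a, b) ∈ μ := by
  rw [le_iff_mem]
  constructor
  · intro h
    exact h _ _ (mem_rect.2 ⟨by simp, by simp⟩)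
  · intro h i j hij
    obtain ⟨h1, h2⟩ := mem_rect.1 hij
    exact μ.up_left_mem (Nat.lt_succ_iff.1 h1) (Nat.lt_succ_iff.1 h2) h

theorem rect_zero_left (b : ℕ) : rect 0 b = ⊥ := by
  rw [eq_bot_iff, le_iff_mem]; intro i j h; simp [mem_rect] at h

theorem rect_zero_right (a : ℕ) : rect a 0 = ⊥ := by
  rw [eq_bot_iff, le_iff_mem]; intro i j h; simp [mem_rect] at h

theorem rect_le_iff {a b : ℕ} {μ : YoungDiagram} : rect (a + 1) b ≤ μ ↔ b ≤ μ.rowLen a := by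
  cases b with
  | zero => simp [rect_zero_right]
  | succ b => rw [rect_succ_le, YoungDiagram.mem_iff_lt_rowLen, Nat.succ_le_iff]

theorem rect_le_iff_colLen {a b : ℕ} {μ : YoungDiagram} : rect a (b + 1) ≤ μ ↔ a ≤ μ.colLen b := by
  cases a with
  | zero => simp [rect_zero_left]
  | succ b => rw [rect_succ_le, YoungDiagram.mem_iff_lt_colLen, Nat.succ_le_iff]

theorem row_le_row {m n : ℕ} : rect 1 m ≤ rect 1 n ↔ m ≤ n := by
  cases m with
  | zero => simp [rect_zero_right]
  | succ m => rw [← zero_add 1, rect_succ_le, mem_rect]; simp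

theorem col_le_col {m n : ℕ} : rect m 1 ≤ rect n 1 ↔ m ≤ n := by
  cases m with
  | zero => simp [rect_zero_left]
  | succ m => rw [← zero_add 1, rect_succ_le, mem_rect]; simp

/-- The first column and the first row alone bound all cells of a diagram. This characterizes a
rectangle by a column and a row, which `DefFun.rect_col` turns into a formula. -/
theorem le_rect_iff {a b : ℕ} {μ : YoungDiagram} :
    μ ≤ rect a b ↔ (∀ i, rect i 1 ≤ μ → i ≤ a) ∧ (∀ j, rect 1 j ≤ μ → j ≤ b) := by
  constructor
  · intro h
    constructor
    · rintro (_ | i) hi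
      · simp
      · rw [← zero_add 1, rect_succ_le] at hi
        exact (mem_rect.1 (h hi)).1
    · rintro (_ | i) hi
      · simp
      · rw [← zero_add 1, rect_succ_le] at hi
        exact (mem_rect.1 (h hi)).2
  · rintro ⟨h1, h2⟩
    rw [le_iff_mem]
    intro i j hij
    refine mem_rect.2 ⟨h1 (i + 1) ?_, h2 (j + 1) ?_⟩
    · rw [← zero_add 1, ← add_assoc, rect_succ_le]
      exact μ.up_left_mem le_rfl (Nat.zero_le _) hij
    · rw [← zero_add 1, ← add_assoc, rect_succ_le]
      exact μ.up_left_mem (Nat.zero_le _) le_rfl hij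

theorem eq_row_of_notMem {μ : YoungDiagram} (h : (1, 0) ∉ μ) : ∃ n, μ = rect 1 n := by
  refine ⟨μ.rowLen 0, le_antisymm ?_ (rect_le_iff.2 le_rfl)⟩
  rw [le_rect_iff]
  refine ⟨fun i hi => ?_, fun j hj => rect_le_iff.1 hj⟩
  by_contra hlt
  obtain ⟨k, rfl⟩ : ∃ k, i = k + 2 := ⟨i - 2, by omega⟩
  exact h (μ.up_left_mem (by omega) le_rfl (rect_succ_le.1 hi))

theorem eq_col_of_notMem {μ : YoungDiagram} (h : (0, 1) ∉ μ) : ∃ n, μ = rect n 1 := by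
  refine ⟨μ.colLen 0, le_antisymm ?_ (rect_le_iff_colLen.2 le_rfl)⟩
  rw [le_rect_iff]
  refine ⟨fun j hj => rect_le_iff_colLen.1 hj, fun i hi => ?_⟩
  by_contra hlt
  obtain ⟨k, rfl⟩ : ∃ k, i = k + 2 := ⟨i - 2, by omega⟩
  exact h (μ.up_left_mem le_rfl (by omega) (rect_succ_le.1 hi))

theorem le_row_iff {μ : YoungDiagram} {n : ℕ} : μ ≤ rect 1 n ↔ ∃ m ≤ n, μ = rect 1 m := by
  constructor
  · intro h
    obtain ⟨m, rfl⟩ := eq_row_of_notMem (μ := μ) (fun h' => by simpa [mem_rect] using h h')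
    exact ⟨m, row_le_row.1 h, rfl⟩
  · rintro ⟨m, hm, rfl⟩
    exact row_le_row.2 hm

theorem le_col_iff {μ : YoungDiagram} {n : ℕ} : μ ≤ rect n 1 ↔ ∃ m ≤ n, μ = rect m 1 := by
  constructor
  · intro h
    obtain ⟨m, rfl⟩ := eq_col_of_notMem (μ := μ) (fun h' => by simpa [mem_rect] using h h')
    exact ⟨m, col_le_col.1 h, rfl⟩
  · rintro ⟨m, hm, rfl⟩
    exact col_le_col.2 hm

theorem row_injective {m n : ℕ} (h : rect 1 m = rect 1 n) : m = n :=
  le_antisymm (row_le_row.1 h.le) (row_le_row.1 h.ge)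

theorem col_injective {m n : ℕ} (h : rect m 1 = rect n 1) : m = n :=
  le_antisymm (col_le_col.1 h.le) (col_le_col.1 h.ge)

theorem two_row_le_iff {μ : YoungDiagram} : rect 1 2 ≤ μ ↔ (0, 1) ∈ μ := rect_succ_le

theorem two_col_le_iff {μ : YoungDiagram} : rect 2 1 ≤ μ ↔ (1, 0) ∈ μ := rect_succ_le

/-- The diagrams below which all diagrams are comparable; these are the rows and the columns. -/
def ChainBelow (μ : YoungDiagram) : Prop := ∀ a, a ≤ μ → ∀ b, b ≤ μ → a ≤ b ∨ b ≤ a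

theorem ChainBelow.notMem {μ : YoungDiagram} (h : ChainBelow μ) : (0, 1) ∉ μ ∨ (1, 0) ∉ μ := by
  by_contra! hc
  rcases h _ (two_row_le_iff.2 hc.1) _ (two_col_le_iff.2 hc.2) with h | h
  · rw [two_row_le_iff, mem_rect] at h; simp at h
  · rw [two_col_le_iff, mem_rect] at h; simp at h

theorem chainBelow_row (n : ℕ) : ChainBelow (rect 1 n) := by
  intro a ha b hb
  obtain ⟨i, _, rfl⟩ := le_row_iff.1 ha
  obtain ⟨j, _, rfl⟩ := le_row_iff.1 hb
  simpa [row_le_row] using le_total i j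

theorem chainBelow_col (n : ℕ) : ChainBelow (rect n 1) := by
  intro a ha b hb
  obtain ⟨i, _, rfl⟩ := le_col_iff.1 ha
  obtain ⟨j, _, rfl⟩ := le_col_iff.1 hb
  simpa [col_le_col] using le_total i j

/-- The two diagrams of size two are incomparable, so a diagram with a chain below it omits one of
them and is a row or a column. Comparability with `rect 1 2` excludes exactly the columns of height
at least two; the empty diagram and the single cell count both as rows and as columns. -/
theorem isRow_iff {μ : YoungDiagram} :
    (ChainBelow μ ∧ (μ ≤ rect 1 2 ∨ rect 1 2 ≤ μ)) ↔ ∃ n, rect 1 n = μ := by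
  constructor
  · rintro ⟨hc, h | h⟩
    · obtain ⟨m, _, rfl⟩ := le_row_iff.1 h
      exact ⟨m, rfl⟩
    · obtain ⟨n, rfl⟩ := eq_row_of_notMem (hc.notMem.resolve_left (not_not.2 (two_row_le_iff.1 h)))
      exact ⟨n, rfl⟩
  · rintro ⟨n, rfl⟩
    exact ⟨chainBelow_row n, by simpa [row_le_row] using le_total n 2⟩

theorem isCol_iff {μ : YoungDiagram} :
    (ChainBelow μ ∧ ¬ rect 1 2 ≤ μ) ↔ ∃ n, rect n 1 = μ := by
  constructor
  · rintro ⟨-, h⟩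
    obtain ⟨n, rfl⟩ := eq_col_of_notMem (fun h' => h (two_row_le_iff.2 h'))
    exact ⟨n, rfl⟩
  · rintro ⟨n, rfl⟩
    exact ⟨chainBelow_col n, by rw [two_row_le_iff, mem_rect]; simp⟩

/-- The diagram with prescribed row lengths. -/
def ofRowLen (f : ℕ → ℕ) (hf : Antitone f) (N : ℕ) (_hN : f N = 0) : YoungDiagram where
  cells := (Finset.range N ×ˢ Finset.range (f 0)).filter fun c => c.2 < f c.1
  isLowerSet := by
    rintro ⟨i, j⟩ ⟨i', j'⟩ ⟨h1, h2⟩ h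
    dsimp only at h1 h2
    simp only [Finset.coe_filter, Finset.mem_product, Finset.mem_range, Set.mem_ofPred_eq] at h ⊢
    have := hf h1
    omega

theorem rowLen_ofRowLen {f : ℕ → ℕ} (hf : Antitone f) {N : ℕ} (hN : f N = 0) (i : ℕ) :
    (ofRowLen f hf N hN).rowLen i = f i := by
  have key : ∀ j, j < (ofRowLen f hf N hN).rowLen i ↔ j < f i := by
    intro j
    rw [← YoungDiagram.mem_iff_lt_rowLen, ← YoungDiagram.mem_cells]
    simp only [ofRowLen, Finset.mem_filter, Finset.mem_product,
      Finset.mem_range]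
    refine ⟨fun h => h.2, fun h => ⟨⟨?_, ?_⟩, h⟩⟩
    · by_contra hlt
      have := hf (not_lt.1 hlt)
      omega
    · have := hf (Nat.zero_le i)
      omega
  exact le_antisymm (not_lt.1 fun h => lt_irrefl _ ((key _).1 h))
    (not_lt.1 fun h => lt_irrefl _ ((key _).2 h))

theorem exists_rowLen_eq {f : ℕ → ℕ} (hf : Antitone f) {N : ℕ} (hN : f N = 0) :
    ∃ μ : YoungDiagram, ∀ i, μ.rowLen i = f i :=
  ⟨ofRowLen f hf N hN, rowLen_ofRowLen hf hN⟩

end YoungLattice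

namespace YoungLattice

/-! ### Definability in contexts -/

/-- A context is a type whose elements are tuples of Young diagrams (or of objects named by Young
diagrams), one of them being the row of size two. -/
class Ctx (Γ : Type) where
  /-- the index set of the tuples -/
  Idx : Type
  /-- the entries of a tuple -/
  env : Γ → Idx → YoungDiagram
  /-- the index of the row of size two -/
  par : Idx
  env_par : ∀ γ, env γ par = rect 1 2

instance : Ctx Unit := ⟨Unit, fun _ _ => rect 1 2, (), fun _ => rfl⟩

/-- A predicate on a context is definable if some first-order formula defines it. -/
def Def {Γ : Type} [Ctx Γ] (P : Γ → Prop) : Prop :=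
  ∃ φ : Language.order.Formula (Ctx.Idx Γ), ∀ γ, φ.Realize (Ctx.env γ) ↔ P γ

/-- A type of objects named by the elements of a definable set of Young diagrams. -/
class Slot (X : Type) where
  /-- the name of an object -/
  emb : X → YoungDiagram
  emb_injective : Function.Injective emb
  exists_formula : ∃ φ : Language.order.Formula (Unit ⊕ Unit), ∀ y,
    φ.Realize (Sum.elim (fun _ => rect 1 2) (fun _ => y)) ↔ ∃ x, emb x = y

instance (Γ X : Type) [Ctx Γ] [Slot X] : Ctx (Γ × X) where
  Idx := Ctx.Idx Γ ⊕ Unit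
  env p := Sum.elim (Ctx.env p.1) (fun _ => Slot.emb p.2)
  par := Sum.inl Ctx.par
  env_par p := Ctx.env_par p.1

instance : Slot YoungDiagram where
  emb := id
  emb_injective := Function.injective_id
  exists_formula := ⟨⊤, fun y => by simp⟩

section Def

variable {Γ Δ X Y Z : Type} [Ctx Γ] [Ctx Δ] [Slot X] [Slot Y] [Slot Z]

theorem Def.of_iff {P Q : Γ → Prop} (h : Def P) (hPQ : ∀ γ, Q γ ↔ P γ) : Def Q := by
  obtain ⟨φ, hφ⟩ := h
  exact ⟨φ, fun γ => (hφ γ).trans (hPQ γ).symm⟩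

theorem Def.not {P : Γ → Prop} (h : Def P) : Def fun γ => ¬ P γ := by
  obtain ⟨φ, hφ⟩ := h
  exact ⟨φ.not, fun γ => by rw [Language.Formula.realize_not, hφ]⟩

theorem Def.and {P Q : Γ → Prop} (hP : Def P) (hQ : Def Q) : Def fun γ => P γ ∧ Q γ := by
  obtain ⟨φ, hφ⟩ := hP
  obtain ⟨ψ, hψ⟩ := hQ
  exact ⟨φ ⊓ ψ, fun γ => by rw [Language.Formula.realize_inf, hφ, hψ]⟩

theorem Def.or {P Q : Γ → Prop} (hP : Def P) (hQ : Def Q) : Def fun γ => P γ ∨ Q γ :=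
  (hP.not.and hQ.not).not.of_iff fun γ => by tauto

theorem Def.imp {P Q : Γ → Prop} (hP : Def P) (hQ : Def Q) : Def fun γ => P γ → Q γ :=
  (hP.and hQ.not).not.of_iff fun γ => by tauto

theorem Def.iff {P Q : Γ → Prop} (hP : Def P) (hQ : Def Q) : Def fun γ => P γ ↔ Q γ :=
  ((hP.imp hQ).and (hQ.imp hP)).of_iff fun γ => by tauto

/-- A map of contexts that only copies entries. -/
def Subst (s : Γ → Δ) : Prop :=
  ∃ g : Ctx.Idx Δ → Ctx.Idx Γ, ∀ γ i, Ctx.env (s γ) i = Ctx.env γ (g i)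

theorem Def.subst {P : Δ → Prop} (h : Def P) {s : Γ → Δ} (hs : Subst s) :
    Def fun γ => P (s γ) := by
  obtain ⟨φ, hφ⟩ := h
  obtain ⟨g, hg⟩ := hs
  refine ⟨φ.relabel g, fun γ => ?_⟩
  rw [Language.Formula.realize_relabel, show Ctx.env γ ∘ g = Ctx.env (s γ) from
    funext fun i => (hg γ i).symm]
  exact hφ (s γ)

/-- An entry of a context. -/
def IsVar (f : Γ → X) : Prop := ∃ i, ∀ γ, Slot.emb (f γ) = Ctx.env γ i

theorem IsVar.snd : IsVar fun p : Γ × X => p.2 := ⟨.inr (), fun _ => rfl⟩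

theorem IsVar.up {f : Γ → X} (h : IsVar f) : IsVar fun p : Γ × Y => f p.1 := by
  obtain ⟨i, hi⟩ := h
  exact ⟨.inl i, fun γ => hi γ.1⟩

theorem Subst.fst : Subst fun p : Γ × X => p.1 := ⟨Sum.inl, fun _ _ => rfl⟩

theorem Subst.unit : Subst fun _ : Γ => () := ⟨fun _ => Ctx.par, fun γ _ => (Ctx.env_par γ).symm⟩

theorem Subst.comp {Θ : Type} [Ctx Θ] {s : Γ → Δ} {t : Δ → Θ} (ht : Subst t) (hs : Subst s) :
    Subst fun γ => t (s γ) := by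
  obtain ⟨g, hg⟩ := hs
  obtain ⟨k, hk⟩ := ht
  exact ⟨g ∘ k, fun γ i => by rw [hk, hg]; rfl⟩

theorem Subst.pair {s : Γ → Δ} {f : Γ → X} (hs : Subst s) (hf : IsVar f) :
    Subst fun γ => (s γ, f γ) := by
  obtain ⟨g, hg⟩ := hs
  obtain ⟨k, hk⟩ := hf
  refine ⟨Sum.elim g fun _ => k, fun γ i => ?_⟩
  cases i with
  | inl i => exact hg γ i
  | inr i => exact hk γ

/-- The quantifier is relativized to the definable set of names of objects of `X`; the parameter in
the defining formula of that set is read from the entry `par` of the context. -/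
theorem Def.ex {P : Γ × X → Prop} (h : Def P) : Def fun γ => ∃ x, P (γ, x) := by
  obtain ⟨φ, hφ⟩ := h
  obtain ⟨ρ, hρ⟩ := Slot.exists_formula (X := X)
  refine ⟨((ρ.relabel (Sum.map (fun _ => Ctx.par) id)) ⊓ φ).iExs Unit, fun γ => ?_⟩
  rw [Language.Formula.realize_iExs]
  have key : ∀ i : Unit → YoungDiagram, (ρ.relabel (Sum.map (fun _ => Ctx.par) id) ⊓ φ).Realize
      (Sum.elim (Ctx.env γ) i) ↔ (∃ x : X, Slot.emb x = i ()) ∧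
        φ.Realize (Sum.elim (Ctx.env γ) i) := by
    intro i
    rw [Language.Formula.realize_inf, Language.Formula.realize_relabel, ← hρ]
    refine and_congr_left' ?_
    rw [show Sum.elim (Ctx.env γ) i ∘ Sum.map (fun _ => Ctx.par) id =
      Sum.elim (fun _ : Unit => rect 1 2) (fun _ : Unit => i ()) from ?_]
    funext j
    cases j with
    | inl j => exact Ctx.env_par γ
    | inr j => rfl
  constructor
  · rintro ⟨i, hi⟩
    obtain ⟨⟨x, hx⟩, h2⟩ := (key i).1 hi
    refine ⟨x, (hφ (γ, x)).1 ?_⟩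
    rwa [show Ctx.env (γ, x) = Sum.elim (Ctx.env γ) i from ?_]
    funext j
    cases j with
    | inl j => rfl
    | inr j => exact hx
  · rintro ⟨x, hx⟩
    exact ⟨fun _ => Slot.emb x, (key _).2 ⟨⟨x, rfl⟩, (hφ (γ, x)).2 hx⟩⟩

theorem Def.all {P : Γ × X → Prop} (h : Def P) : Def fun γ => ∀ x, P (γ, x) :=
  (Def.ex h.not).not.of_iff fun γ => by push Not; rfl

theorem Def.le_var {f g : Γ → YoungDiagram} (hf : IsVar f) (hg : IsVar g) :
    Def fun γ => f γ ≤ g γ := by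
  obtain ⟨i, hi⟩ := hf
  obtain ⟨j, hj⟩ := hg
  refine ⟨Language.Relations.formula₂ Language.leSymb
    (Language.Term.var i) (Language.Term.var j), fun γ => ?_⟩
  rw [Language.Formula.realize_rel₂]
  change Ctx.env γ i ≤ Ctx.env γ j ↔ _
  rw [← hi, ← hj]; rfl

/-- A function on a context is definable if its graph is. -/
def DefFun (f : Γ → X) : Prop := Def fun p : Γ × X => f p.1 = p.2

theorem emb_isVar {f : Γ → X} (hf : IsVar f) : IsVar fun γ => (Slot.emb (f γ) : YoungDiagram) := hf

/-- Names are injective, so equality of objects is containment of their names in both directions. -/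
theorem IsVar.def {f : Γ → X} (hf : IsVar f) : DefFun f :=
  ((Def.le_var (emb_isVar hf.up) (emb_isVar IsVar.snd)).and
    (Def.le_var (emb_isVar IsVar.snd) (emb_isVar hf.up))).of_iff fun _ =>
    ⟨fun h => ⟨(congrArg Slot.emb h).le, (congrArg Slot.emb h).ge⟩,
      fun h => Slot.emb_injective (le_antisymm h.1 h.2)⟩

theorem DefFun.snd : DefFun fun p : Γ × X => p.2 := IsVar.snd.def

theorem DefFun.up {f : Γ → X} (h : DefFun f) : DefFun fun p : Γ × Y => f p.1 :=
  Def.subst (P := fun p : Γ × X => f p.1 = p.2) h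
    (s := fun p : (Γ × Y) × X => (p.1.1, p.2)) ((Subst.fst.comp Subst.fst).pair IsVar.snd)

/-- A definable function is substituted by quantifying over its value and using its graph. Through
`Def.comp₁` and `Def.comp₂`, a result proved once over `Unit` applies in every context. -/
theorem Def.app {P : Γ → X → Prop} {f : Γ → X} (h : Def fun p : Γ × X => P p.1 p.2)
    (hf : DefFun f) : Def fun γ => P γ (f γ) :=
  (Def.ex (Def.and hf h)).of_iff fun γ => by simp

theorem Def.comp₁ {P : X → Prop} (h : Def fun p : Unit × X => P p.2) {f : Γ → X}
    (hf : DefFun f) : Def fun γ => P (f γ) :=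
  Def.app (P := fun _ x => P x)
    (h.subst (s := fun p : Γ × X => ((), p.2)) (Subst.unit.pair IsVar.snd)) hf

theorem Def.comp₂ {P : X → Y → Prop} (h : Def fun p : (Unit × X) × Y => P p.1.2 p.2)
    {f : Γ → X} {g : Γ → Y} (hf : DefFun f) (hg : DefFun g) : Def fun γ => P (f γ) (g γ) :=
  Def.app (P := fun γ y => P (f γ) y)
    (Def.app (P := fun (p : Γ × Y) x => P x p.2)
      (h.subst (s := fun p : (Γ × Y) × X => (((), p.2), p.1.2))
        ((Subst.unit.pair IsVar.snd).pair IsVar.snd.up)) hf.up) hg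

theorem DefFun.comp₁ {F : X → Z} (h : DefFun fun p : Unit × X => F p.2) {f : Γ → X}
    (hf : DefFun f) : DefFun fun γ => F (f γ) :=
  Def.comp₂ (P := fun x z => F x = z) h hf.up DefFun.snd

theorem Def.le {f g : Γ → YoungDiagram} (hf : DefFun f) (hg : DefFun g) : Def fun γ => f γ ≤ g γ :=
  Def.comp₂ (P := fun x y : YoungDiagram => x ≤ y) (Def.le_var IsVar.snd.up IsVar.snd) hf hg

theorem Def.eq {f g : Γ → X} (hf : DefFun f) (hg : DefFun g) : Def fun γ => f γ = g γ :=
  Def.comp₂ (P := fun x y : X => x = y) (DefFun.snd (Γ := Unit)) hf hg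

theorem DefFun.emb {f : Γ → X} (hf : DefFun f) : DefFun fun γ => (Slot.emb (f γ) : YoungDiagram) :=
  DefFun.comp₁ (F := fun x : X => Slot.emb x) (emb_isVar IsVar.snd).def hf

theorem DefFun.par : DefFun fun _ : Γ => rect 1 2 :=
  IsVar.def ⟨Ctx.par, fun γ => (Ctx.env_par γ).symm⟩

end Def

end YoungLattice

namespace YoungLattice

/-! ### Definability of arithmetic -/

section Vars

variable {Γ X X₁ X₂ X₃ X₄ : Type} [Ctx Γ] [Slot X] [Slot X₁] [Slot X₂] [Slot X₃] [Slot X₄]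

theorem DefFun.var0 : DefFun fun p : Γ × X => p.2 := DefFun.snd
theorem DefFun.var1 : DefFun fun p : (Γ × X) × X₁ => p.1.2 := DefFun.snd.up
theorem DefFun.var2 : DefFun fun p : ((Γ × X) × X₁) × X₂ => p.1.1.2 := DefFun.snd.up.up
theorem DefFun.var3 : DefFun fun p : (((Γ × X) × X₁) × X₂) × X₃ => p.1.1.1.2 := DefFun.snd.up.up.up
theorem DefFun.var4 : DefFun fun p : ((((Γ × X) × X₁) × X₂) × X₃) × X₄ => p.1.1.1.1.2 :=
  DefFun.snd.up.up.up.up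

end Vars

open DefFun

theorem def_chainBelow {Γ : Type} [Ctx Γ] {f : Γ → YoungDiagram} (hf : DefFun f) :
    Def fun γ => ChainBelow (f γ) := by
  unfold ChainBelow
  exact Def.all (Def.imp (Def.le var0 hf.up) (Def.all (Def.imp (Def.le var0 hf.up.up)
    (Def.or (Def.le var1 var0) (Def.le var0 var1)))))

/-- A natural number is named by a row. -/
instance : Slot ℕ where
  emb n := rect 1 n
  emb_injective _ _ h := row_injective h
  exists_formula := by
    obtain ⟨φ, hφ⟩ := Def.of_iff (Def.and (def_chainBelow (Γ := Unit × YoungDiagram) var0)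
      (Def.or (Def.le var0 par) (Def.le par var0))) fun γ => isRow_iff.symm
    exact ⟨φ, fun y => hφ ((), y)⟩

/-- A copy of the natural numbers in which a number is named by a column. -/
structure Col where
  /-- the underlying number -/
  n : ℕ

instance : Slot Col where
  emb c := rect c.n 1
  emb_injective := fun ⟨_⟩ ⟨_⟩ h => congrArg Col.mk (col_injective h)
  exists_formula := by
    obtain ⟨φ, hφ⟩ := Def.of_iff (Def.and (def_chainBelow (Γ := Unit × YoungDiagram) var0)
      (Def.not (Def.le par var0))) fun γ => isCol_iff.symm
    exact ⟨φ, fun y => (hφ ((), y)).trans ⟨fun ⟨n, h⟩ => ⟨⟨n⟩, h⟩, fun ⟨c, h⟩ => ⟨c.n, h⟩⟩⟩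

section Arith

variable {Γ : Type} [Ctx Γ]

theorem Def.le_nat {f g : Γ → ℕ} (hf : DefFun f) (hg : DefFun g) : Def fun γ => f γ ≤ g γ :=
  (Def.le hf.emb hg.emb).of_iff fun _ => row_le_row.symm

theorem Def.le_col {f g : Γ → Col} (hf : DefFun f) (hg : DefFun g) :
    Def fun γ => (f γ).n ≤ (g γ).n :=
  (Def.le hf.emb hg.emb).of_iff fun _ => col_le_col.symm

theorem Def.lt_nat {f g : Γ → ℕ} (hf : DefFun f) (hg : DefFun g) : Def fun γ => f γ < g γ :=
  (Def.le_nat hg hf).not.of_iff fun _ => not_le.symm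

theorem DefFun.succ {f : Γ → ℕ} (hf : DefFun f) : DefFun fun γ => f γ + 1 := by
  refine Def.of_iff (Def.all (Def.iff (Def.lt_nat hf.up.up var0) (Def.le_nat var1 var0)))
    fun p => ?_
  constructor
  · rintro h k; rw [← h]; exact Iff.rfl
  · intro h
    exact le_antisymm ((h _).2 le_rfl) ((h _).1 (Nat.lt_succ_self _))

theorem DefFun.succ_col {f : Γ → Col} (hf : DefFun f) : DefFun fun γ => Col.mk ((f γ).n + 1) := by
  refine Def.of_iff (Def.all (X := Col) (Def.iff (Def.not (Def.le_col var0 hf.up.up))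
    (Def.le_col var1 var0))) fun p => ?_
  constructor
  · rintro h k; rw [← h, not_le]; exact Iff.rfl
  · intro h
    have h1 := (h p.2).2 le_rfl
    have h2 := (h ⟨_⟩).1 (not_le.2 (Nat.lt_succ_self (f p.1).n))
    cases hp : p.2 with
    | mk n => simp only [hp] at h1 h2 ⊢; congr 1; omega

theorem DefFun.zero : DefFun fun _ : Γ => 0 :=
  Def.of_iff (Def.all (Def.le_nat var1 var0)) fun _ =>
    ⟨fun h k => h ▸ Nat.zero_le k, fun h => (Nat.le_zero.1 (h 0)).symm⟩

theorem DefFun.rect_col {f : Γ → Col} {g : Γ → ℕ} (hf : DefFun f) (hg : DefFun g) :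
    DefFun fun γ => rect (f γ).n (g γ) := by
  refine Def.of_iff (Def.all (X := YoungDiagram) (Def.iff (Def.le var0 var1) (Def.and
    (Def.all (X := Col) (Def.imp (Def.le (emb var0) var1) (Def.le_col var0 hf.up.up.up)))
    (Def.all (X := ℕ) (Def.imp (Def.le (emb var0) var1) (Def.le_nat var0 hg.up.up.up))))))
    fun p => ?_
  have key : ∀ x, (x ≤ p.2 ↔ (∀ c : Col, Slot.emb c ≤ x → c.n ≤ (f p.1).n) ∧
      ∀ n : ℕ, Slot.emb n ≤ x → n ≤ g p.1) ↔ (x ≤ p.2 ↔ x ≤ rect (f p.1).n (g p.1)) := by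
    intro x
    rw [le_rect_iff]
    exact iff_congr Iff.rfl (and_congr ⟨fun h i => h ⟨i⟩, fun h i => h i.n⟩ Iff.rfl)
  constructor
  · rintro h x; exact (key x).2 (by rw [← h])
  · intro h
    refine eq_of_forall_le_iff fun x => ?_
    rw [← (key x).1 (h x)]

/-- In a diagram in which the antidiagonals are uniform, the first row is as long as the first
column. -/
theorem rowLen_eq_colLen_of_uniform {μ : YoungDiagram}
    (h : ∀ i j, (i + 1, j) ∈ μ ↔ (i, j + 1) ∈ μ) : μ.rowLen 0 = μ.colLen 0 := by
  have key : ∀ k i, (i + k, 0) ∈ μ ↔ (i, k) ∈ μ := by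
    intro k
    induction k with
    | zero => simp
    | succ k ih =>
      intro i
      rw [← h, ← ih, show i + (k + 1) = i + 1 + k by omega]
  refine eq_of_forall_lt_iff fun k => ?_
  rw [← YoungDiagram.mem_iff_lt_rowLen, ← YoungDiagram.mem_iff_lt_colLen, ← key, zero_add]

theorem antitone_sub (n : ℕ) : Antitone fun i => n - i := fun _ _ h => Nat.sub_le_sub_left h n

/-- A staircase is as wide as it is high. The first condition on μ compares the cells (i + 1, j) and
(i, j + 1): each antidiagonal lies entirely inside or entirely outside μ, which forces the first row
and the first column to have equal length. -/
theorem col_eq_iff (n : ℕ) (c : Col) : Col.mk n = c ↔ ∃ μ : YoungDiagram,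
    (∀ (i : Col) (j : ℕ), rect (i.n + 1 + 1) (j + 1) ≤ μ ↔ rect (i.n + 1) (j + 1 + 1) ≤ μ) ∧
    (∀ j : ℕ, Slot.emb j ≤ μ ↔ j ≤ n) ∧ (∀ i : Col, Slot.emb i ≤ μ ↔ i.n ≤ c.n) := by
  constructor
  · rintro rfl
    -- The staircase with row lengths n, n - 1, …, 1.
    obtain ⟨μ, hμ⟩ := exists_rowLen_eq (antitone_sub n) (Nat.sub_self n)
    refine ⟨μ, fun i j => ?_,
      fun j => ?_, fun i => ?_⟩
    · rw [rect_succ_le, rect_succ_le, YoungDiagram.mem_iff_lt_rowLen,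
        YoungDiagram.mem_iff_lt_rowLen, hμ, hμ]
      omega
    · change rect (0 + 1) j ≤ _ ↔ _
      rw [rect_le_iff, hμ, Nat.sub_zero]
    · change rect i.n 1 ≤ _ ↔ _
      cases i.n with
      | zero => simp [rect_zero_left]
      | succ i =>
        rw [rect_le_iff, hμ]
        dsimp only
        omega
  · rintro ⟨μ, h1, h2, h3⟩
    have h := rowLen_eq_colLen_of_uniform (μ := μ) fun i j => by
      rw [← rect_succ_le, ← rect_succ_le]; exact h1 ⟨i⟩ j
    have hr : μ.rowLen 0 = n := eq_of_forall_le_iff fun k => by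
      rw [← rect_le_iff]; exact h2 k
    have hc : μ.colLen 0 = c.n := eq_of_forall_le_iff fun k => by
      rw [← rect_le_iff_colLen]; exact h3 ⟨k⟩
    cases c; congr 1; exact hr.symm.trans (h.trans hc)

theorem DefFun.col {f : Γ → ℕ} (hf : DefFun f) : DefFun fun γ => Col.mk (f γ) :=
  Def.of_iff (Def.ex (X := YoungDiagram) (Def.and
    (Def.all (X := Col) (Def.all (X := ℕ) (Def.iff
      (Def.le (rect_col (succ_col (succ_col var1)) (succ var0)) var2)
      (Def.le (rect_col (succ_col var1) (succ (succ var0))) var2))))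
    (Def.and (Def.all (X := ℕ) (Def.iff (Def.le (emb var0) var1) (Def.le_nat var0 hf.up.up.up)))
      (Def.all (X := Col) (Def.iff (Def.le (emb var0) var1) (Def.le_col var0 var2))))))
    fun p => col_eq_iff (f p.1) p.2

theorem DefFun.rect {f g : Γ → ℕ} (hf : DefFun f) (hg : DefFun g) :
    DefFun fun γ => rect (f γ) (g γ) := rect_col hf.col hg

theorem DefFun.rowLen {f : Γ → YoungDiagram} {g : Γ → ℕ} (hf : DefFun f) (hg : DefFun g) :
    DefFun fun γ => (f γ).rowLen (g γ) := by
  refine Def.of_iff (Def.all (X := ℕ) (Def.iff (Def.le_nat var0 var1)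
    (Def.le (DefFun.rect hg.up.up.succ var0) hf.up.up))) fun p => ?_
  simp only [rect_le_iff]
  exact ⟨fun h k => by rw [h], fun h => (eq_of_forall_le_iff h).symm⟩

/-- The diagram loses one cell per row during its first a steps, going from length a + b down to b.
-/
theorem add_eq_iff (a b c : ℕ) : a + b = c ↔ ∃ μ : YoungDiagram, μ.rowLen 0 = c ∧
    μ.rowLen a = b ∧ ∀ i, i < a → μ.rowLen i = μ.rowLen (i + 1) + 1 := by
  constructor
  · rintro rfl
    obtain ⟨μ, hμ⟩ := exists_rowLen_eq (antitone_sub (a + b)) (Nat.sub_self _)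
    refine ⟨μ, ?_, ?_, fun i hi => ?_⟩ <;> simp only [hμ] <;> omega
  · rintro ⟨μ, rfl, rfl, h⟩
    have : ∀ k ≤ a, k + μ.rowLen k = μ.rowLen 0 := by
      intro k
      induction k with
      | zero => simp
      | succ k ih => intro hk; rw [← ih (by omega), h k (by omega)]; omega
    exact this a le_rfl

theorem DefFun.add {f g : Γ → ℕ} (hf : DefFun f) (hg : DefFun g) : DefFun fun γ => f γ + g γ :=
  Def.of_iff (Def.ex (X := YoungDiagram) (Def.and (Def.eq (DefFun.rowLen var0 zero) var1) (Def.and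
    (Def.eq (DefFun.rowLen var0 hf.up.up) hg.up.up) (Def.all (X := ℕ) (Def.imp
      (Def.lt_nat var0 hf.up.up.up)
      (Def.eq (DefFun.rowLen var1 var0) (DefFun.succ (DefFun.rowLen var1 (succ var0)))))))))
    fun p => add_eq_iff (f p.1) (g p.1) p.2

/-- Here each of the a steps loses b cells and the last one ends at length zero, so multiplication
is iterated addition recorded in one diagram. -/
theorem mul_eq_iff (a b c : ℕ) : a * b = c ↔ ∃ μ : YoungDiagram, μ.rowLen 0 = c ∧
    μ.rowLen a = 0 ∧ ∀ i, i < a → μ.rowLen i = μ.rowLen (i + 1) + b := by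
  constructor
  · rintro rfl
    obtain ⟨μ, hμ⟩ := exists_rowLen_eq (f := fun i => (a - i) * b)
      (fun _ _ h => Nat.mul_le_mul_right _ (Nat.sub_le_sub_left h a)) (N := a) (by simp)
    refine ⟨μ, ?_, ?_, fun i hi => ?_⟩
    · rw [hμ, Nat.sub_zero]
    · rw [hμ, Nat.sub_self, zero_mul]
    · rw [hμ, hμ, show a - i = a - (i + 1) + 1 by omega, Nat.succ_mul]
  · rintro ⟨μ, rfl, h0, h⟩
    have : ∀ k ≤ a, k * b + μ.rowLen k = μ.rowLen 0 := by
      intro k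
      induction k with
      | zero => simp
      | succ k ih => intro hk; rw [← ih (by omega), h k (by omega), Nat.succ_mul]; omega
    rw [← this a le_rfl, h0, add_zero]

theorem DefFun.mul {f g : Γ → ℕ} (hf : DefFun f) (hg : DefFun g) : DefFun fun γ => f γ * g γ :=
  Def.of_iff (Def.ex (X := YoungDiagram) (Def.and (Def.eq (DefFun.rowLen var0 zero) var1) (Def.and
    (Def.eq (DefFun.rowLen var0 hf.up.up) zero) (Def.all (X := ℕ) (Def.imp
      (Def.lt_nat var0 hf.up.up.up)
      (Def.eq (DefFun.rowLen var1 var0)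
        (DefFun.add (DefFun.rowLen var1 (succ var0)) hg.up.up.up)))))))
    fun p => mul_eq_iff (f p.1) (g p.1) p.2

theorem DefFun.pair {f g : Γ → ℕ} (hf : DefFun f) (hg : DefFun g) :
    DefFun fun γ => Nat.pair (f γ) (g γ) := by
  refine Def.of_iff (Def.or
    (Def.and (Def.lt_nat hf.up hg.up) (Def.eq ((hg.up.mul hg.up).add hf.up) var0))
    (Def.and (Def.not (Def.lt_nat hf.up hg.up))
      (Def.eq (((hf.up.mul hf.up).add hf.up).add hg.up) var0))) fun p => ?_
  dsimp only [Nat.pair]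
  split_ifs with h <;> simp [h]

theorem DefFun.unpair_fst {f : Γ → ℕ} (hf : DefFun f) : DefFun fun γ => (f γ).unpair.1 :=
  Def.of_iff (Def.ex (X := ℕ) (Def.eq (DefFun.pair var1 var0) hf.up.up)) fun p =>
    ⟨fun h => ⟨(f p.1).unpair.2, by rw [← h, Nat.pair_unpair]⟩,
      fun ⟨b, h⟩ => by dsimp only at h ⊢; rw [← h, Nat.unpair_pair]⟩

theorem DefFun.unpair_snd {f : Γ → ℕ} (hf : DefFun f) : DefFun fun γ => (f γ).unpair.2 :=
  Def.of_iff (Def.ex (X := ℕ) (Def.eq (DefFun.pair var0 var1) hf.up.up)) fun p =>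
    ⟨fun h => ⟨(f p.1).unpair.1, by rw [← h, Nat.pair_unpair]⟩,
      fun ⟨b, h⟩ => by dsimp only at h ⊢; rw [← h, Nat.unpair_pair]⟩

end Arith

/-! ### Definability of recursively enumerable predicates -/

/-- Every finite sequence occurs as the sequence of differences of row lengths of a diagram. -/
theorem exists_rowLen_sub (s : ℕ → ℕ) (n : ℕ) :
    ∃ μ : YoungDiagram, ∀ i ≤ n, μ.rowLen i = μ.rowLen (i + 1) + s i := by
  induction n generalizing s with
  | zero =>
    have hf : Antitone fun i => if i = 0 then s 0 else 0 := fun i j h => by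
      dsimp only; split_ifs <;> omega
    obtain ⟨μ, hμ⟩ := exists_rowLen_eq hf (N := 1) rfl
    refine ⟨μ, fun i hi => ?_⟩
    obtain rfl := Nat.le_zero.1 hi
    rw [hμ, hμ]
    simp
  | succ n ih =>
    obtain ⟨μ, hμ⟩ := ih fun i => s (i + 1)
    obtain ⟨N, hN⟩ : ∃ N, μ.rowLen N = 0 := by
      obtain ⟨N, hN⟩ := μ.exists_notMem_col 0
      rw [YoungDiagram.mem_cells, YoungDiagram.mem_iff_lt_rowLen] at hN
      exact ⟨N, by omega⟩
    -- A new first row is put on top of the diagram for the shifted sequence, longer by `s 0` than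
    -- the old first row.
    let f : ℕ → ℕ := fun i => i.casesOn (μ.rowLen 0 + s 0) μ.rowLen
    have hf : Antitone f := antitone_nat_of_succ_le fun i => by
      cases i with
      | zero => exact Nat.le_add_right _ _
      | succ i => exact μ.rowLen_anti _ _ (Nat.le_succ i)
    obtain ⟨ν, hν⟩ := exists_rowLen_eq hf (N := N + 1) hN
    refine ⟨ν, fun i hi => ?_⟩
    rw [hν, hν]
    cases i with
    | zero => rfl
    | succ i => exact hμ i (by omega)

/-- The differences of consecutive row lengths of μ record the successive values of the recursion,
so no arithmetical coding of sequences is needed. -/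
theorem mem_rec_iff {f : Part ℕ} {g : ℕ → ℕ → Part ℕ} {n y : ℕ} :
    y ∈ (Nat.rec f (fun k IH => IH.bind fun i => g k i) n : Part ℕ) ↔
      ∃ μ : YoungDiagram, (∃ x, x ∈ f ∧ μ.rowLen 0 = μ.rowLen (0 + 1) + x) ∧
        (∀ i, i < n → ∀ a b, μ.rowLen i = μ.rowLen (i + 1) + a →
          μ.rowLen (i + 1) = μ.rowLen (i + 1 + 1) + b → b ∈ g i a) ∧
        μ.rowLen n = μ.rowLen (n + 1) + y := by
  constructor
  · intro h
    have : ∃ s : ℕ → ℕ, s 0 ∈ f ∧ (∀ i < n, s (i + 1) ∈ g i (s i)) ∧ s n = y := by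
      induction n generalizing y with
      | zero => exact ⟨fun _ => y, h, by simp, rfl⟩
      | succ n ih =>
        obtain ⟨x, hx, hy⟩ := Part.mem_bind_iff.1 h
        obtain ⟨s, h0, h1, h2⟩ := ih hx
        refine ⟨fun i => if i ≤ n then s i else y, by simpa using h0, fun i hi => ?_, by simp⟩
        rcases Nat.lt_succ_iff_lt_or_eq.1 hi with hi | rfl
        · simpa [hi.le, Nat.succ_le_of_lt hi] using h1 i hi
        · simpa [h2] using hy
    obtain ⟨s, h0, h1, h2⟩ := this
    obtain ⟨μ, hμ⟩ := exists_rowLen_sub s n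
    refine ⟨μ, ⟨s 0, h0, hμ 0 (Nat.zero_le _)⟩, fun i hi a b ha hb => ?_, by rw [hμ n le_rfl, h2]⟩
    have e1 := hμ i hi.le
    have e2 := hμ (i + 1) hi
    obtain rfl : a = s i := by omega
    obtain rfl : b = s (i + 1) := by omega
    exact h1 i hi
  · rintro ⟨μ, ⟨x, hx, h0⟩, h1, h2⟩
    have : ∀ k ≤ n, ∀ z, μ.rowLen k = μ.rowLen (k + 1) + z →
        z ∈ (Nat.rec f (fun k IH => IH.bind fun i => g k i) k : Part ℕ) := by
      intro k
      induction k with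
      | zero => intro _ z hz; obtain rfl : z = x := by simp only [zero_add] at h0 hz; omega
                exact hx
      | succ k ih =>
        intro hk z hz
        -- Row lengths decrease weakly, so the k-th difference exists as a natural number and the
        -- step condition, stated for all a and b, is not vacuous.
        have hanti := μ.rowLen_anti k (k + 1) (Nat.le_succ k)
        have e : μ.rowLen k = μ.rowLen (k + 1) + (μ.rowLen k - μ.rowLen (k + 1)) := by omega
        exact Part.mem_bind_iff.2 ⟨_, ih (by omega) _ e, h1 k hk _ _ e hz⟩
    exact this n le_rfl y h2

/-- Graphs are what survives the induction: pairing and composition quantify over intermediate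
values, primitive recursion quantifies over a diagram as in `mem_rec_iff`, and minimization is a
bounded universal condition. -/
theorem def_of_partrec {f : ℕ →. ℕ} (hf : Nat.Partrec f) :
    Def fun p : (Unit × ℕ) × ℕ => p.2 ∈ f p.1.2 := by
  induction hf with
  | zero => exact (Def.eq var0 zero).of_iff fun p => by simp [pure, PFun.pure]
  | succ => exact (Def.eq var0 (succ var1)).of_iff fun p => by simp
  | left => exact (Def.eq var0 (unpair_fst var1)).of_iff fun p => by simp
  | right => exact (Def.eq var0 (unpair_snd var1)).of_iff fun p => by simp
  | @pair f g _ _ hf hg =>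
    refine (Def.ex (X := ℕ) (Def.ex (X := ℕ) (Def.and (Def.eq (DefFun.pair var1 var0) var2)
      (Def.and (Def.comp₂ (P := fun x y => y ∈ f x) hf var3 var1)
        (Def.comp₂ (P := fun x y => y ∈ g x) hg var3 var0))))).of_iff fun p => ?_
    simp only [Part.mem_map_iff, seq_eq_bind_map, Part.bind_eq_bind, Part.mem_bind_iff,
      Part.map_eq_map]
    constructor
    · rintro ⟨_, ⟨a, ha, rfl⟩, b, hb, h⟩
      exact ⟨a, b, h, ha, hb⟩
    · rintro ⟨a, b, h, ha, hb⟩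
      exact ⟨_, ⟨a, ha, rfl⟩, b, hb, h⟩
  | @comp f g _ _ hf hg =>
    refine (Def.ex (X := ℕ) (Def.and (Def.comp₂ (P := fun x y => y ∈ g x) hg var2 var0)
        (Def.comp₂ (P := fun x y => y ∈ f x) hf var0 var1))).of_iff fun p => ?_
    exact Part.mem_bind_iff (f := g p.1.2) (g := f)
  | @prec f g _ _ hf hg =>
    refine (Def.ex (X := YoungDiagram) (Def.and
      (Def.ex (X := ℕ) (Def.and
        (Def.comp₂ (P := fun x y => y ∈ f x) hf (unpair_fst var3) var0)
        (Def.eq (DefFun.rowLen var1 zero) (add (DefFun.rowLen var1 (succ zero)) var0))))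
      (Def.and
        (Def.all (X := ℕ) (Def.imp (Def.lt_nat var0 (unpair_snd var3))
          (Def.all (X := ℕ) (Def.all (X := ℕ) (Def.imp
            (Def.eq (DefFun.rowLen var3 var2) (add (DefFun.rowLen var3 (succ var2)) var1))
            (Def.imp (Def.eq (DefFun.rowLen var3 (succ var2))
              (add (DefFun.rowLen var3 (succ (succ var2))) var0))
              (Def.comp₂ (P := fun x y => y ∈ g x) hg
                (DefFun.pair (unpair_fst var4.up) (DefFun.pair var2 var1)) var0)))))))
        (Def.eq (DefFun.rowLen var0 (unpair_snd var2))
          (add (DefFun.rowLen var0 (succ (unpair_snd var2))) var1))))).of_iff fun p => ?_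
    exact mem_rec_iff (f := f p.1.2.unpair.1)
      (g := fun k i => g (Nat.pair p.1.2.unpair.1 (Nat.pair k i)))
  | @rfind f _ hf =>
    refine (Def.and (Def.comp₂ (P := fun x y => y ∈ f x) hf (DefFun.pair var1 var0) zero)
      (Def.all (X := ℕ) (Def.imp (Def.lt_nat var0 var1) (Def.ex (X := ℕ) (Def.and
        (Def.comp₂ (P := fun x y => y ∈ f x) hf (DefFun.pair var3 var1) var0)
        (Def.not (Def.eq var0 zero))))))).of_iff fun p => ?_
    have e : ∀ m (b : Bool), b ∈ (fun m => decide (m = 0)) <$> f (Nat.pair p.1.2 m) ↔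
        ∃ k ∈ f (Nat.pair p.1.2 m), decide (k = 0) = b := fun m b => Part.mem_map_iff _
    refine Nat.mem_rfind.trans (and_congr ?_ (forall_congr' fun m => forall_congr' fun _ => ?_))
    · rw [e]; simp
    · rw [e]; simp

theorem def_of_rePred {P : ℕ → Prop} (h : REPred P) : Def fun p : Unit × ℕ => P p.2 := by
  -- A partial recursive function with domain `P` and constant value 0; projecting its graph yields
  -- `P`.
  have h' : Nat.Partrec fun n => Part.map (fun _ => 0) (Part.assert (P n) fun _ => Part.some ()) :=
    Partrec.nat_iff.1 (Partrec.map h (Computable.const 0).to₂)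
  refine (Def.ex (X := ℕ) (def_of_partrec h')).of_iff fun p => ?_
  simp

end YoungLattice

namespace YoungLattice

/-! ### Gödel numbers of sentences about numerals -/

/-- The atomic formula `xᵢ ≤ xⱼ`. -/
def leFormula {n : ℕ} (i j : Fin n) : Language.order.BoundedFormula Empty n :=
  .rel (l := 2) Language.orderRel.le ![.var (.inr i), .var (.inr j)]

theorem realize_leFormula {n : ℕ} (i j : Fin n) (v : Empty → YoungDiagram)
    (xs : Fin n → YoungDiagram) : (leFormula i j).Realize v xs ↔ xs i ≤ xs j := Iff.rfl

theorem formulaCode_leFormula {n : ℕ} (i j : Fin n) :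
    formulaCode (leFormula i j) = 4 * Nat.pair i j + 2 := by
  simp [leFormula, formulaCode, termCode]

/-- The formula saying that a chain of `n` successive covers leads from the bottom element to the
last variable, provided that the latter is a row. -/
def numeralFormula : (n k : ℕ) → Language.order.BoundedFormula Empty (k + 1)
  | 0, k => .all (leFormula (Fin.last k).castSucc (Fin.last (k + 1)))
  | n + 1, k => .not <| .all <|
      .imp (leFormula (Fin.last (k + 1)) (Fin.last k).castSucc) <|
      .imp (.not (leFormula (Fin.last k).castSucc (Fin.last (k + 1)))) <|
      .imp (.all (.imp (leFormula (Fin.last (k + 2)) (Fin.last k).castSucc.castSucc)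
        (.imp (.not (leFormula (Fin.last (k + 2)) (Fin.last (k + 1)).castSucc))
          (leFormula (Fin.last k).castSucc.castSucc (Fin.last (k + 2)))))) <|
      .not (numeralFormula n (k + 1))

/-- Only shorter rows lie below a row, so a lower cover of a row is the row that is one cell
shorter, and the bottom element is the row of length zero. -/
theorem realize_numeralFormula (n : ℕ) : ∀ (k m : ℕ) (v : Empty → YoungDiagram)
    (xs : Fin (k + 1) → YoungDiagram), xs (Fin.last k) = rect 1 m →
      ((numeralFormula n k).Realize v xs ↔ m = n) := by
  induction n with
  | zero =>
    intro k m v xs h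
    simp only [numeralFormula, Language.BoundedFormula.realize_all, realize_leFormula, Fin.snoc_last,
      Fin.snoc_castSucc, h]
    constructor
    · intro h'
      have := h' (rect 1 0)
      rw [row_le_row] at this
      omega
    · rintro rfl z
      rw [rect_zero_right]
      exact bot_le
  | succ n ih =>
    intro k m v xs h
    simp only [numeralFormula, Language.BoundedFormula.realize_all, Language.BoundedFormula.realize_not,
      Language.BoundedFormula.realize_imp, realize_leFormula, Fin.snoc_last, Fin.snoc_castSucc, h]
    push Not
    constructor
    · rintro ⟨x, h1, h2, h3, h4⟩
      obtain ⟨j, hj, rfl⟩ := le_row_iff.1 h1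
      rw [ih _ j _ _ (by simp)] at h4
      rw [row_le_row] at h2
      have := h3 (rect 1 (j + 1)) (row_le_row.2 (by omega)) (by rw [row_le_row]; omega)
      rw [row_le_row] at this
      omega
    · rintro rfl
      refine ⟨rect 1 n, row_le_row.2 (by omega), by rw [row_le_row]; omega, fun z hz hz' => ?_, ?_⟩
      · obtain ⟨j, hj, rfl⟩ := le_row_iff.1 hz
        rw [row_le_row] at hz' ⊢
        omega
      · exact (ih _ n _ _ (by simp)).2 rfl

/-- The code of an implication. -/
def impCode (a b : ℕ) : ℕ := 4 * Nat.pair a b + 3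

/-- The code of the formula `xᵢ ≤ xⱼ`. -/
def leCode (i j : ℕ) : ℕ := 4 * Nat.pair i j + 2

/-- The recursion step in the computation of the code of `numeralFormula`. -/
def numeralStep (k x : ℕ) : ℕ :=
  impCode (4 * impCode (leCode (k + 1) k) (impCode (impCode (leCode k (k + 1)) 0)
    (impCode (4 * impCode (leCode (k + 2) k) (impCode (impCode (leCode (k + 2) (k + 1)) 0)
      (leCode k (k + 2))) + 4) (impCode x 0))) + 4) 0

theorem formulaCode_numeralFormula_succ (n k : ℕ) :
    formulaCode (numeralFormula (n + 1) k) =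
      numeralStep k (formulaCode (numeralFormula n (k + 1))) := by
  simp [numeralFormula, numeralStep, formulaCode, Language.BoundedFormula.not, formulaCode_leFormula,
    impCode, leCode]

/-- Variables are numbered from the outside in, so the innermost subformula has the largest indices.
The code is therefore built from the inside out: for the numeral N the base case sits at level N +
1, and step j produces the formula at level N - j, ending at level 1. -/
theorem primrec_formulaCode_numeralFormula :
    Primrec fun n => formulaCode (numeralFormula n 1) := by
  have himp : Primrec₂ impCode := Primrec.nat_add.comp
    (Primrec.nat_mul.comp (.const 4) (Primrec₂.natPair.comp .fst .snd)) (.const 3)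
  have hle : Primrec₂ leCode := Primrec.nat_add.comp
    (Primrec.nat_mul.comp (.const 4) (Primrec₂.natPair.comp .fst .snd)) (.const 2)
  have hall : ∀ {f : ℕ × ℕ → ℕ}, Primrec f → Primrec fun p => 4 * f p + 4 := fun hf =>
    Primrec.nat_add.comp (Primrec.nat_mul.comp (.const 4) hf) (.const 4)
  have h1 : Primrec fun p : ℕ × ℕ => p.1 + 1 := Primrec.nat_add.comp .fst (.const 1)
  have h2 : Primrec fun p : ℕ × ℕ => p.1 + 2 := Primrec.nat_add.comp .fst (.const 2)
  have hstep : Primrec₂ numeralStep := himp.comp (hall (himp.comp (hle.comp h1 .fst)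
    (himp.comp (himp.comp (hle.comp .fst h1) (.const 0)) (himp.comp (hall (himp.comp
      (hle.comp h2 .fst) (himp.comp (himp.comp (hle.comp h2 h1) (.const 0)) (hle.comp .fst h2))))
      (himp.comp .snd (.const 0)))))) (.const 0)
  have hbase : Primrec fun N : ℕ => 4 * leCode (N + 1) (N + 2) + 4 :=
    Primrec.nat_add.comp (Primrec.nat_mul.comp (.const 4) (hle.comp
      (Primrec.nat_add.comp .id (.const 1)) (Primrec.nat_add.comp .id (.const 2)))) (.const 4)
  have hrec : Primrec₂ fun N j : ℕ => (Nat.rec (4 * leCode (N + 1) (N + 2) + 4)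
      (fun j x => numeralStep (N - j) x) j : ℕ) :=
    Primrec.nat_rec hbase (hstep.comp (Primrec.nat_sub.comp .fst (Primrec.fst.comp .snd))
      (Primrec.snd.comp .snd)).to₂
  refine (hrec.comp .id .id).of_eq fun N => ?_
  have key : ∀ j k, j + k = N + 1 → (Nat.rec (4 * leCode (N + 1) (N + 2) + 4)
      (fun j x => numeralStep (N - j) x) j : ℕ) = formulaCode (numeralFormula j k) := by
    intro j
    induction j with
    | zero =>
      intro k hk
      obtain rfl : k = N + 1 := by omega
      simp [numeralFormula, formulaCode, formulaCode_leFormula, leCode]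
    | succ j ih =>
      intro k hk
      rw [formulaCode_numeralFormula_succ, ← ih (k + 1) (by omega)]
      obtain rfl : k = N - j := by omega
      rfl
  exact key N 1 rfl

/-! ### Elimination of the parameter -/

/-- The formula expressing that exactly three elements lie below `x₀` and that they form a
chain. -/
def twoFormula : Language.order.BoundedFormula Empty 1 :=
  .ex <| leFormula 1 0 ⊓ .not (leFormula 0 1) ⊓ .not (.all (leFormula 1 2)) ⊓
    .all (.imp (leFormula 2 0) (.imp (.not (leFormula 0 2)) (leFormula 2 1))) ⊓
    .all (.imp (leFormula 2 1) (.imp (.not (leFormula 1 2)) (.all (leFormula 2 3))))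

theorem realize_twoFormula (v : Empty → YoungDiagram) (xs : Fin 1 → YoungDiagram) :
    twoFormula.Realize v xs ↔ xs 0 = rect 1 2 ∨ xs 0 = rect 2 1 := by
  have e : twoFormula.Realize v xs ↔ ∃ z, z ≤ xs 0 ∧ ¬ xs 0 ≤ z ∧ ¬ (∀ w, z ≤ w) ∧
      (∀ w, w ≤ xs 0 → ¬ xs 0 ≤ w → w ≤ z) ∧ (∀ w, w ≤ z → ¬ z ≤ w → ∀ u, w ≤ u) := by
    simp only [twoFormula, Language.BoundedFormula.realize_ex, Language.BoundedFormula.realize_inf,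
      Language.BoundedFormula.realize_not, Language.BoundedFormula.realize_all,
      Language.BoundedFormula.realize_imp, realize_leFormula, and_assoc]
    exact Iff.rfl
  rw [e]
  generalize xs 0 = c
  have h11 : ∀ w : YoungDiagram, ¬ (∀ u, w ≤ u) → rect 1 1 ≤ w := by
    intro w hw
    by_contra h
    refine hw fun u => ?_
    obtain ⟨n, rfl⟩ := eq_row_of_notMem (μ := w)
      fun h' => h (rect_succ_le.2 (w.up_left_mem (Nat.zero_le 1) le_rfl h'))
    rw [row_le_row] at h
    obtain rfl : n = 0 := by omega
    rw [rect_zero_right]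
    exact bot_le
  constructor
  · rintro ⟨z, h1, h2, h3, h4, h5⟩
    have hz := h11 z h3
    have hz' : z ≤ rect 1 1 := by
      by_contra h
      have h := h5 _ hz h (rect 1 0)
      rw [row_le_row] at h
      omega
    -- By now z is the single cell and c is not contained in it, so c contains one of the two
    -- diagrams of size two. If that containment were proper, `h4` would put a diagram of size two
    -- inside the single cell.
    by_cases hr : (0, 1) ∈ c
    · left
      refine le_antisymm ?_ (two_row_le_iff.2 hr)
      by_contra h
      have h := (h4 _ (two_row_le_iff.2 hr) h).trans hz'
      rw [row_le_row] at h
      omega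
    · by_cases hc : (1, 0) ∈ c
      · right
        refine le_antisymm ?_ (two_col_le_iff.2 hc)
        by_contra h
        have h := (h4 _ (two_col_le_iff.2 hc) h).trans hz'
        rw [col_le_col] at h
        omega
      · obtain ⟨n, rfl⟩ := eq_row_of_notMem hc
        refine absurd (le_trans ?_ hz) h2
        rw [← two_row_le_iff, row_le_row] at hr
        rw [row_le_row]
        omega
  · have aux : ∀ w, w ≤ rect 1 1 → ¬ rect 1 1 ≤ w → ∀ u, w ≤ u := fun w _ h2 => by
      by_contra h
      exact h2 (h11 w h)
    have aux' : ¬ ∀ w, rect 1 1 ≤ w := fun h => by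
      have := h (rect 1 0)
      rw [row_le_row] at this
      omega
    rintro (rfl | rfl)
    · refine ⟨rect 1 1, by simp [row_le_row], by simp [row_le_row], aux', fun w hw hw' => ?_, aux⟩
      obtain ⟨m, hm, rfl⟩ := le_row_iff.1 hw
      rw [row_le_row] at hw' ⊢
      omega
    · refine ⟨rect 1 1, by simp [col_le_col], by simp [col_le_col], aux', fun w hw hw' => ?_, aux⟩
      obtain ⟨m, hm, rfl⟩ := le_col_iff.1 hw
      rw [col_le_col] at hw' ⊢
      omega

theorem rect_transpose (a b : ℕ) : (rect a b).transpose = rect b a := by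
  refine SetLike.ext fun c => ?_
  rw [YoungDiagram.mem_transpose, mem_rect, mem_rect]
  exact and_comm

/-- Transposition as an automorphism of the first-order structure of Young diagrams. -/
def transposeEquiv : YoungDiagram ≃[Language.order] YoungDiagram where
  toEquiv := YoungDiagram.transposeOrderIso.toEquiv
  map_fun' f := Empty.elim f
  map_rel' := by
    rintro n (_ | _) x
    exact YoungDiagram.transpose_le_iff

theorem realize_transpose {n : ℕ} (φ : Language.order.BoundedFormula Empty n)
    (v : Empty → YoungDiagram) (xs : Fin n → YoungDiagram) :
    φ.Realize v (fun i => (xs i).transpose) ↔ φ.Realize v xs := by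
  rw [← Language.StrongHomClass.realize_boundedFormula transposeEquiv φ (xs := xs),
    Subsingleton.elim (transposeEquiv ∘ v) v]
  rfl

/-- The sentence expressing that the number `n` has the property defined by `φ`. -/
def instanceSentence (φ : Language.order.BoundedFormula Empty 2) (n : ℕ) :
    Language.order.Sentence :=
  .not <| .all <| .imp twoFormula <| .all <| .imp φ <| .not <| numeralFormula n 1

theorem primrec_formulaCode_instanceSentence (φ : Language.order.BoundedFormula Empty 2) :
    Primrec fun n => formulaCode (instanceSentence φ n) := by
  have himp : Primrec₂ impCode := Primrec.nat_add.comp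
    (Primrec.nat_mul.comp (.const 4) (Primrec₂.natPair.comp .fst .snd)) (.const 3)
  have hall : ∀ {f : ℕ → ℕ}, Primrec f → Primrec fun p => 4 * f p + 4 := fun hf =>
    Primrec.nat_add.comp (Primrec.nat_mul.comp (.const 4) hf) (.const 4)
  exact himp.comp (hall (himp.comp (.const (formulaCode twoFormula))
    (hall (himp.comp (.const (formulaCode φ)) (himp.comp primrec_formulaCode_numeralFormula
      (.const 0)))))) (.const 0)

/-- The quantified parameter may be the row or the column of size two. Transposition carries a
witness y for the column to the witness `y.transpose` for the row, so both choices give the same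
truth value. -/
theorem realize_instanceSentence {φ : Language.order.BoundedFormula Empty 2} {P : ℕ → Prop}
    (hφ : ∀ v y, φ.Realize v ![rect 1 2, y] ↔ ∃ n, P n ∧ rect 1 n = y) (n : ℕ) :
    YoungDiagram ⊨ instanceSentence φ n ↔ P n := by
  have body : ∀ v y, φ.Realize v ![rect 1 2, y] ∧
      (numeralFormula n 1).Realize v ![rect 1 2, y] ↔ P n ∧ y = rect 1 n := by
    intro v y
    rw [hφ]
    constructor
    · rintro ⟨⟨m, hm, rfl⟩, h⟩
      rw [realize_numeralFormula n 1 m _ _ rfl] at h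
      exact ⟨h ▸ hm, by rw [h]⟩
    · rintro ⟨h, rfl⟩
      exact ⟨⟨n, h, rfl⟩, (realize_numeralFormula n 1 n _ _ rfl).2 rfl⟩
  have tr : ∀ (ψ : Language.order.BoundedFormula Empty 2) v (y : YoungDiagram),
      ψ.Realize v ![rect 2 1, y] ↔ ψ.Realize v ![rect 1 2, y.transpose] := by
    intro ψ v y
    rw [← realize_transpose ψ]
    refine iff_of_eq (congrArg _ (funext fun i => ?_))
    fin_cases i
    · exact rect_transpose 2 1
    · rfl
  have e : ∀ v, YoungDiagram ⊨ instanceSentence φ n ↔ ∃ c, (c = rect 1 2 ∨ c = rect 2 1) ∧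
      ∃ y, φ.Realize v ![c, y] ∧ (numeralFormula n 1).Realize v ![c, y] := by
    intro v
    obtain rfl : v = @default _ Unique.instInhabited := Subsingleton.elim _ _
    have s1 : ∀ (d : Fin 0 → YoungDiagram) (c : YoungDiagram),
        Fin.snoc (α := fun _ => YoungDiagram) d c = ![c] := fun d c =>
      funext fun i => by fin_cases i; rfl
    have s2 : ∀ c y : YoungDiagram, Fin.snoc (α := fun _ => YoungDiagram) ![c] y = ![c, y] :=
      fun c y =>
      funext fun i => by fin_cases i <;> rfl
    simp only [instanceSentence, Language.Sentence.Realize, Language.Formula.Realize,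
      Language.BoundedFormula.realize_not, Language.BoundedFormula.realize_all,
      Language.BoundedFormula.realize_imp, realize_twoFormula, s1, s2]
    push Not
    rfl
  rw [e default]
  constructor
  · rintro ⟨c, rfl | rfl, y, h⟩
    · exact ((body _ y).1 h).1
    · rw [tr, tr] at h
      exact ((body _ _).1 h).1
  · intro h
    exact ⟨_, .inl rfl, _, (body _ _).2 ⟨h, rfl⟩⟩

theorem exists_boundedFormula {P : ℕ → Prop} (h : Def fun p : Unit × ℕ => P p.2) :
    ∃ φ : Language.order.BoundedFormula Empty 2,
      ∀ v y, φ.Realize v ![rect 1 2, y] ↔ ∃ n, P n ∧ rect 1 n = y := by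
  have h' : Def fun p : Unit × YoungDiagram => ∃ n, P n ∧ rect 1 n = p.2 :=
    (Def.ex (Def.and (Def.comp₁ h DefFun.var0) (Def.eq (DefFun.emb DefFun.var0) DefFun.var1)))
  obtain ⟨ψ, hψ⟩ := h'
  refine ⟨Language.BoundedFormula.relabel (n := 2) (Sum.elim (fun _ => Sum.inr 0) fun _ => Sum.inr 1) ψ, fun v y => ?_⟩
  refine Iff.trans ?_ (hψ ((), y))
  rw [Language.BoundedFormula.realize_relabel, Language.Formula.Realize]
  refine iff_of_eq (congrArg₂ _ (funext fun i => ?_) (Subsingleton.elim _ _))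
  rcases i with i | i <;> rfl

theorem rePred_comp {α β : Type*} [Primcodable α] [Primcodable β] {p : β → Prop} (hp : REPred p)
    {f : α → β} (hf : Computable f) : REPred fun a => p (f a) :=
  Partrec.comp (f := fun b => Part.assert (p b) fun _ => Part.some ()) hp hf

/-- The set of Gödel numbers of the sentences true in Young's lattice is not the restriction of a
recursively enumerable set to the Gödel numbers of sentences. -/
theorem not_rePred_of_iff_mem_elementaryTheory {P : ℕ → Prop}
    (hP : ∀ σ : Language.order.Sentence, P (formulaCode σ) ↔ σ ∈ elementaryTheory) :
    ¬ REPred P := by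
  intro hre
  have hK : REPred fun n : ℕ => ((Denumerable.ofNat Nat.Partrec.Code n).eval 0).Dom :=
    rePred_comp (ComputablePred.halting_problem_re 0) (Computable.ofNat _)
  -- Definability, unlike recursive enumerability, is closed under negation: non-halting is
  -- definable because halting is.
  obtain ⟨φ, hφ⟩ := exists_boundedFormula
    (P := fun n => ¬ ((Denumerable.ofNat Nat.Partrec.Code n).eval 0).Dom) (def_of_rePred hK).not
  refine ComputablePred.halting_problem_not_re 0 ?_
  have hc : Computable fun c : Nat.Partrec.Code =>
      formulaCode (instanceSentence φ (Encodable.encode c)) :=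
    (primrec_formulaCode_instanceSentence φ).to_comp.comp Computable.encode
  refine REPred.of_eq (rePred_comp hre hc) fun c => ?_
  have key := realize_instanceSentence hφ (Encodable.encode c)
  rw [Denumerable.ofNat_encode] at key
  rw [← key, hP]
  rfl

end YoungLattice

namespace YoungLattice

/-! ### Unsatisfiability of recursive sets of clauses is recursively enumerable -/

theorem rePred_exists {p : ℕ → ℕ → Prop} (hp : PrimrecRel p) : REPred fun k => ∃ n, p k n := by
  classical
  have h : Primrec₂ fun k n => decide (p k n) := hp.decide
  have h' := Partrec.rfind (p := fun k n => Part.some (decide (p k n))) h.to_comp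
  refine REPred.of_eq h'.dom_re fun k => ?_
  refine Nat.rfind_dom'.trans ?_
  constructor
  · rintro ⟨n, hn, -⟩
    exact ⟨n, by simpa using hn⟩
  · rintro ⟨n, hn⟩
    exact ⟨n, by simpa using hn, fun {m} _ => trivial⟩

/-- A list of clauses is satisfied by a truth assignment if every clause contains a true literal. -/
def Satisfies (H : ℕ → Bool) (cs : List (List (ℕ × Bool))) : Prop :=
  ∀ c ∈ cs, ∃ l ∈ c, H l.1 = l.2

theorem isClosed_satisfies (cs : List (List (ℕ × Bool))) : IsClosed {H | Satisfies H cs} := by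
  have : {H : ℕ → Bool | Satisfies H cs} =
      ⋂ c ∈ cs, ⋃ l ∈ {l | l ∈ c}, {H : ℕ → Bool | H l.1 = l.2} := by
    ext H
    simp [Satisfies]
  rw [this]
  exact isClosed_biInter fun c _ => (List.finite_toSet c).isClosed_biUnion fun l _ =>
    isClosed_eq (continuous_apply l.1) continuous_const

/-- Propositional compactness. -/
theorem exists_satisfies {cs : ℕ → List (List (ℕ × Bool))}
    (h : ∀ n, ∃ H, ∀ j < n, Satisfies H (cs j)) : ∃ H, ∀ j, Satisfies H (cs j) := by
  -- Satisfying assignments form closed subsets of Cantor space; a finite set of indices is bounded,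
  -- so the hypothesis supplies the finite intersection property.
  obtain ⟨H, hH⟩ := CompactSpace.iInter_nonempty (t := fun j => {H | Satisfies H (cs j)})
    (fun j => isClosed_satisfies (cs j)) fun s => by
      obtain ⟨H, hH⟩ := h (s.sup id + 1)
      refine ⟨H, Set.mem_iInter₂.2 fun j hj => hH j ?_⟩
      exact Nat.lt_succ_of_le (Finset.le_sup (f := id) hj)
  exact ⟨H, fun j => Set.mem_iInter.1 hH j⟩

/-- All lists of truth values of a given length. -/
def boolLists (n : ℕ) : List (List Bool) :=
  n.rec [ [] ] fun _ L => L.flatMap fun l => [true :: l, false :: l]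

theorem mem_boolLists {n : ℕ} {l : List Bool} : l ∈ boolLists n ↔ l.length = n := by
  induction n generalizing l with
  | zero => simp [boolLists]
  | succ n ih =>
    change l ∈ (boolLists n).flatMap _ ↔ _
    simp only [List.mem_flatMap, ih, List.mem_cons, List.not_mem_nil, or_false]
    constructor
    · rintro ⟨a, rfl, rfl | rfl⟩ <;> rfl
    · intro h
      cases l with
      | nil => simp at h
      | cons b l =>
        refine ⟨l, by simpa using h, ?_⟩
        cases b <;> simp

theorem primrec_boolLists : Primrec boolLists := by
  refine Primrec.nat_rec₁ [ [] ] ?_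
  refine Primrec.list_flatMap .snd ?_
  exact Primrec.list_cons.comp (Primrec.list_cons.comp (.const true) .snd)
    (Primrec.list_cons.comp (Primrec.list_cons.comp (.const false) .snd) (.const []))

/-- A strict upper bound for the atoms occurring in a list of clauses. -/
def atomBound (cs : List (List (ℕ × Bool))) : ℕ :=
  cs.flatten.foldr (fun l b => max (l.1 + 1) b) 0

theorem lt_atomBound {cs : List (List (ℕ × Bool))} {c : List (ℕ × Bool)} (hc : c ∈ cs)
    {l : ℕ × Bool} (hl : l ∈ c) : l.1 < atomBound cs := by
  have : ∀ L : List (ℕ × Bool), l ∈ L → l.1 < L.foldr (fun l b => max (l.1 + 1) b) 0 := by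
    intro L
    induction L with
    | nil => simp
    | cons a L ih =>
      intro h
      rcases List.mem_cons.1 h with rfl | h
      · exact lt_max_of_lt_left (Nat.lt_succ_self _)
      · exact lt_max_of_lt_right (ih h)
  exact this _ (List.mem_flatten.2 ⟨c, hc, hl⟩)

theorem primrec_atomBound : Primrec atomBound :=
  Primrec.list_foldr Primrec.list_flatten (.const 0) <|
    (Primrec.nat_max.comp (Primrec.succ.comp (Primrec.fst.comp (Primrec.fst.comp .snd)))
      (Primrec.snd.comp .snd)).to₂

/-- A strict upper bound for the atoms occurring in the first `n` lists of clauses. -/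
def atomBoundUpTo (cs : ℕ → List (List (ℕ × Bool))) (n : ℕ) : ℕ :=
  n.rec 0 fun j b => max b (atomBound (cs j))

theorem atomBound_le_upTo {cs : ℕ → List (List (ℕ × Bool))} {n j : ℕ} (h : j < n) :
    atomBound (cs j) ≤ atomBoundUpTo cs n := by
  induction n with
  | zero => omega
  | succ n ih =>
    rcases Nat.lt_succ_iff_lt_or_eq.1 h with h | rfl
    · exact (ih h).trans (le_max_left _ _)
    · exact le_max_right _ _

/-- Only the atoms below the bound occur, so an assignment may be replaced by a finite list of truth
values. -/
theorem exists_satisfies_iff_boolLists {cs : ℕ → List (List (ℕ × Bool))} {n : ℕ} :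
    (∃ H, ∀ j < n, Satisfies H (cs j)) ↔ ∃ L ∈ boolLists (atomBoundUpTo cs n),
      ∀ j < n, ∀ c ∈ cs j, ∃ l ∈ c, L.getD l.1 false = l.2 := by
  constructor
  · rintro ⟨H, hH⟩
    refine ⟨(List.range (atomBoundUpTo cs n)).map H, mem_boolLists.2 (by simp),
      fun j hj c hc => ?_⟩
    obtain ⟨l, hl, h⟩ := hH j hj c hc
    refine ⟨l, hl, ?_⟩
    have := (lt_atomBound hc hl).trans_le (atomBound_le_upTo hj)
    simp [List.getD, this, h]
  · rintro ⟨L, -, h⟩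
    exact ⟨fun i => L.getD i false, h⟩

/-- By compactness an unsatisfiable family has an unsatisfiable finite initial part, and checking a
given part by truth tables is primitive recursive; what remains is an unbounded search. -/
theorem rePred_unsatisfiable_nat {cs : ℕ → ℕ → List (List (ℕ × Bool))} (hcs : Primrec₂ cs) :
    REPred fun k => ¬ ∃ H, ∀ j, Satisfies H (cs k j) := by
  have hB : Primrec₂ fun k n => atomBoundUpTo (cs k) n := by
    refine Primrec.nat_rec (f := fun _ : ℕ => 0)
      (g := fun k p => max p.2 (atomBound (cs k p.1))) (Primrec.const 0) ?_
    exact (Primrec.nat_max.comp (Primrec.snd.comp .snd)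
      (primrec_atomBound.comp (hcs.comp .fst (Primrec.fst.comp .snd)))).to₂
  have h1 : PrimrecRel fun (l : ℕ × Bool) (L : List Bool) => L.getD l.1 false = l.2 :=
    Primrec.eq.comp ((Primrec.list_getD false).comp .snd (Primrec.fst.comp .fst))
      (Primrec.snd.comp .fst)
  have h2 := h1.exists_mem_list.forall_mem_list
  have h3 : PrimrecRel fun (j : ℕ) (p : ℕ × List Bool) =>
      ∀ c ∈ cs p.1 j, ∃ l ∈ c, p.2.getD l.1 false = l.2 :=
    h2.comp (hcs.comp (Primrec.fst.comp .snd) .fst) (Primrec.snd.comp .snd)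
  have h4 : PrimrecRel fun (L : List Bool) (p : ℕ × ℕ) =>
      ∀ j ∈ List.range p.2, ∀ c ∈ cs p.1 j, ∃ l ∈ c, L.getD l.1 false = l.2 :=
    h3.forall_mem_list.comp (Primrec.list_range.comp (Primrec.snd.comp .snd))
      (Primrec.pair (Primrec.fst.comp .snd) .fst)
  have h5 : PrimrecRel fun k n => ∃ L ∈ boolLists (atomBoundUpTo (cs k) n),
      ∀ j ∈ List.range n, ∀ c ∈ cs k j, ∃ l ∈ c, L.getD l.1 false = l.2 :=
    h4.exists_mem_list.comp (primrec_boolLists.comp hB) .id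
  refine (rePred_exists h5.not).of_eq fun k => ?_
  simp only [List.mem_range, ← exists_satisfies_iff_boolLists]
  rw [← not_forall, not_iff_not]
  exact ⟨exists_satisfies, fun ⟨H, hH⟩ n => ⟨H, fun j _ => hH j⟩⟩

theorem rePred_unsatisfiable {ι : Type} [Primcodable ι] {cs : ℕ → ι → List (List (ℕ × Bool))}
    (hcs : Primrec₂ cs) : REPred fun k => ¬ ∃ H, ∀ x, Satisfies H (cs k x) := by
  -- Numbers that decode to no index contribute the empty list of clauses, which is always
  -- satisfied.
  have h : Primrec₂ fun k j : ℕ => (Option.casesOn (Encodable.decode (α := ι) j) []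
      fun x => cs k x : List (List (ℕ × Bool))) :=
    Primrec.option_casesOn (Primrec.decode.comp .snd) (.const [])
      (hcs.comp (Primrec.fst.comp .fst) .snd).to₂
  refine (rePred_unsatisfiable_nat h).of_eq fun k => not_congr (exists_congr fun H => ?_)
  constructor
  · intro h x
    simpa using h (Encodable.encode x)
  · intro h j
    cases Encodable.decode (α := ι) j with
    | none => simp [Satisfies]
    | some x => exact h x

end YoungLattice

namespace YoungLattice

/-! ### Clauses describing a term model -/

open Encodable (encode)

/-- The code of a universally quantified formula. -/
def allCode (p : ℕ) : ℕ := 4 * p + 4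

/-- The code of an equation. -/
def eqCode (a b : ℕ) : ℕ := 4 * Nat.pair a b + 1

/-- The code of an atomic formula with relation symbol `r` and argument terms `ts`. -/
def relCode (r : ℕ) (ts : List ℕ) : ℕ := 4 * Nat.pair r (encode ts) + 2

/-- The code of a variable as a term. -/
def varCode (i : ℕ) : ℕ := Nat.pair 0 i

/-- The code of a term with function symbol `f` and argument terms `ts`. -/
def fnCode (f : ℕ) (ts : List ℕ) : ℕ := Nat.pair (f + 1) (encode ts)

/-- The element of the term model that is the value of the term `t` at the elements `e`. -/
def closure (t : ℕ) (e : List ℕ) : ℕ := 2 * Nat.pair t (encode e)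

/-- The element of the term model that is a counterexample to `∀ x, p` at the elements `e`, if there
is one. The number `s` tells in which way the formula is coded. -/
def witness (s p : ℕ) (e : List ℕ) : ℕ := 2 * Nat.pair s (Nat.pair p (encode e)) + 1

/-- The propositional atom saying that the elements `e` satisfy the formula `p`. -/
def satAtom (s p : ℕ) (e : List ℕ) : ℕ := 3 * Nat.pair s (Nat.pair p (encode e))

/-- The propositional atom saying that two elements are equal. -/
def eqAtom (a b : ℕ) : ℕ := 3 * Nat.pair a b + 1

/-- The propositional atom saying that two tuples of terms have the same values. -/
def tupAtom (ts e ss e' : List ℕ) : ℕ :=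
  3 * Nat.pair (Nat.pair (encode ts) (encode e)) (Nat.pair (encode ss) (encode e')) + 2

/-- The instances, for given numbers and lists of numbers, of the clauses describing a term model
of the formula coded by `t₀` and of the negation of the formula in the language of orders coded by
`k`, the relation symbol `≤` being identified with the one with number `r₀`. -/
def modelClauses (r₀ t₀ k : ℕ) (x : (ℕ × ℕ × ℕ) × List ℕ × List ℕ × List ℕ × List ℕ) :
    List (List (ℕ × Bool)) :=
  [ [(satAtom 0 k [], false)],
  [(satAtom 1 t₀ [], true)],
  [(satAtom x.1.1 0 x.2.1, false)],
  [(satAtom x.1.1 (impCode x.1.2.1 x.1.2.2) x.2.1, true), (satAtom x.1.1 x.1.2.1 x.2.1, true)],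
  [(satAtom x.1.1 (impCode x.1.2.1 x.1.2.2) x.2.1, true), (satAtom x.1.1 x.1.2.2 x.2.1, false)],
  [(satAtom x.1.1 (impCode x.1.2.1 x.1.2.2) x.2.1, false), (satAtom x.1.1 x.1.2.1 x.2.1, false),
    (satAtom x.1.1 x.1.2.2 x.2.1, true)],
  [(satAtom x.1.1 (allCode x.1.2.1) x.2.1, false),
    (satAtom x.1.1 x.1.2.1 (x.2.1 ++ [x.1.2.2]), true)],
  [(satAtom x.1.1 (allCode x.1.2.1) x.2.1, true),
    (satAtom x.1.1 x.1.2.1 (x.2.1 ++ [witness x.1.1 x.1.2.1 x.2.1]), false)],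
  [(eqAtom x.1.1 x.1.1, true)],
  [(eqAtom x.1.1 x.1.2.1, false), (eqAtom x.1.2.2 x.1.2.1, false), (eqAtom x.1.1 x.1.2.2, true)],
  [(eqAtom (closure (varCode x.1.1) x.2.1) (x.2.1.getD x.1.1 0), true)],
  -- Congruence for an l-ary symbol would need l equality literals in one clause. Atoms for equality
  -- of tuples, built up one entry at a time, let finitely many schemes of bounded width serve all
  -- arities.
  [(tupAtom [] x.2.1 [] x.2.2.1, true)],
  [(eqAtom (closure x.1.1 x.2.1) (closure x.1.2.1 x.2.2.1), false),
    (tupAtom x.2.2.2.1 x.2.1 x.2.2.2.2 x.2.2.1, false),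
    (tupAtom (x.1.1 :: x.2.2.2.1) x.2.1 (x.1.2.1 :: x.2.2.2.2) x.2.2.1, true)],
  [(tupAtom x.2.2.2.1 x.2.1 x.2.2.2.2 x.2.2.1, false),
    (eqAtom (closure (fnCode x.1.1 x.2.2.2.1) x.2.1)
      (closure (fnCode x.1.1 x.2.2.2.2) x.2.2.1), true)],
  [(satAtom 1 (eqCode x.1.1 x.1.2.1) x.2.1, false),
    (eqAtom (closure x.1.1 x.2.1) (closure x.1.2.1 x.2.1), true)],
  [(satAtom 1 (eqCode x.1.1 x.1.2.1) x.2.1, true),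
    (eqAtom (closure x.1.1 x.2.1) (closure x.1.2.1 x.2.1), false)],
  [(tupAtom x.2.2.2.1 x.2.1 x.2.2.2.2 x.2.2.1, false),
    (satAtom 1 (relCode x.1.1 x.2.2.2.1) x.2.1, false),
    (satAtom 1 (relCode x.1.1 x.2.2.2.2) x.2.2.1, true)],
  [(satAtom 0 (eqCode x.1.1 x.1.2.1) x.2.1, false),
    (satAtom 1 (eqCode (varCode x.1.1) (varCode x.1.2.1)) x.2.1, true)],
  [(satAtom 0 (eqCode x.1.1 x.1.2.1) x.2.1, true),
    (satAtom 1 (eqCode (varCode x.1.1) (varCode x.1.2.1)) x.2.1, false)],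
  [(satAtom 0 (leCode x.1.1 x.1.2.1) x.2.1, false),
    (satAtom 1 (relCode r₀ [varCode x.1.1, varCode x.1.2.1]) x.2.1, true)],
  [(satAtom 0 (leCode x.1.1 x.1.2.1) x.2.1, true),
    (satAtom 1 (relCode r₀ [varCode x.1.1, varCode x.1.2.1]) x.2.1, false)] ]

section Primrec

variable {α β : Type} [Primcodable α] [Primcodable β]

theorem primrec_cons {f : α → β} {g : α → List β} (hf : Primrec f) (hg : Primrec g) :
    Primrec fun x => f x :: g x := Primrec.list_cons.comp hf hg

theorem primrec_mul_add (a b : ℕ) {f : α → ℕ} (hf : Primrec f) : Primrec fun x => a * f x + b :=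
  Primrec.nat_add.comp (Primrec.nat_mul.comp (.const a) hf) (.const b)

theorem primrec_impCode {f g : α → ℕ} (hf : Primrec f) (hg : Primrec g) :
    Primrec fun x => impCode (f x) (g x) := primrec_mul_add 4 3 (Primrec₂.natPair.comp hf hg)

theorem primrec_eqCode {f g : α → ℕ} (hf : Primrec f) (hg : Primrec g) :
    Primrec fun x => eqCode (f x) (g x) := primrec_mul_add 4 1 (Primrec₂.natPair.comp hf hg)

theorem primrec_leCode {f g : α → ℕ} (hf : Primrec f) (hg : Primrec g) :
    Primrec fun x => leCode (f x) (g x) := primrec_mul_add 4 2 (Primrec₂.natPair.comp hf hg)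

theorem primrec_allCode {f : α → ℕ} (hf : Primrec f) : Primrec fun x => allCode (f x) :=
  primrec_mul_add 4 4 hf

theorem primrec_relCode {f : α → ℕ} {g : α → List ℕ} (hf : Primrec f) (hg : Primrec g) :
    Primrec fun x => relCode (f x) (g x) :=
  primrec_mul_add 4 2 (Primrec₂.natPair.comp hf (Primrec.encode.comp hg))

theorem primrec_varCode {f : α → ℕ} (hf : Primrec f) : Primrec fun x => varCode (f x) :=
  Primrec₂.natPair.comp (.const 0) hf

theorem primrec_fnCode {f : α → ℕ} {g : α → List ℕ} (hf : Primrec f) (hg : Primrec g) :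
    Primrec fun x => fnCode (f x) (g x) :=
  Primrec₂.natPair.comp (Primrec.succ.comp hf) (Primrec.encode.comp hg)

theorem primrec_closure {f : α → ℕ} {g : α → List ℕ} (hf : Primrec f) (hg : Primrec g) :
    Primrec fun x => closure (f x) (g x) :=
  primrec_mul_add 2 0 (Primrec₂.natPair.comp hf (Primrec.encode.comp hg))

theorem primrec_witness {f g : α → ℕ} {h : α → List ℕ} (hf : Primrec f) (hg : Primrec g)
    (hh : Primrec h) : Primrec fun x => witness (f x) (g x) (h x) :=
  primrec_mul_add 2 1 (Primrec₂.natPair.comp hf (Primrec₂.natPair.comp hg (Primrec.encode.comp hh)))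

theorem primrec_satAtom {f g : α → ℕ} {h : α → List ℕ} (hf : Primrec f) (hg : Primrec g)
    (hh : Primrec h) : Primrec fun x => satAtom (f x) (g x) (h x) :=
  primrec_mul_add 3 0 (Primrec₂.natPair.comp hf (Primrec₂.natPair.comp hg (Primrec.encode.comp hh)))

theorem primrec_eqAtom {f g : α → ℕ} (hf : Primrec f) (hg : Primrec g) :
    Primrec fun x => eqAtom (f x) (g x) := primrec_mul_add 3 1 (Primrec₂.natPair.comp hf hg)

theorem primrec_tupAtom {f g h k : α → List ℕ} (hf : Primrec f) (hg : Primrec g) (hh : Primrec h)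
    (hk : Primrec k) : Primrec fun x => tupAtom (f x) (g x) (h x) (k x) :=
  primrec_mul_add 3 2 (Primrec₂.natPair.comp
    (Primrec₂.natPair.comp (Primrec.encode.comp hf) (Primrec.encode.comp hg))
    (Primrec₂.natPair.comp (Primrec.encode.comp hh) (Primrec.encode.comp hk)))

end Primrec

theorem primrec_modelClauses (r₀ t₀ : ℕ) : Primrec₂ (modelClauses r₀ t₀) := by
  let A := ℕ × (ℕ × ℕ × ℕ) × List ℕ × List ℕ × List ℕ × List ℕ
  have h0 : Primrec fun x : A => x.1 := .fst
  have h1 : Primrec fun x : A => x.2.1.1 := Primrec.fst.comp (Primrec.fst.comp .snd)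
  have h2 : Primrec fun x : A => x.2.1.2.1 :=
    Primrec.fst.comp (Primrec.snd.comp (Primrec.fst.comp .snd))
  have h3 : Primrec fun x : A => x.2.1.2.2 :=
    Primrec.snd.comp (Primrec.snd.comp (Primrec.fst.comp .snd))
  have h : Primrec fun x : A => x.2.2 := Primrec.snd.comp .snd
  have h4 : Primrec fun x : A => x.2.2.1 := Primrec.fst.comp h
  have h5 : Primrec fun x : A => x.2.2.2.1 := Primrec.fst.comp (Primrec.snd.comp h)
  have h6 : Primrec fun x : A => x.2.2.2.2.1 :=
    Primrec.fst.comp (Primrec.snd.comp (Primrec.snd.comp h))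
  have h7 : Primrec fun x : A => x.2.2.2.2.2 :=
    Primrec.snd.comp (Primrec.snd.comp (Primrec.snd.comp h))
  change Primrec fun x : A => modelClauses r₀ t₀ x.1 x.2
  unfold modelClauses
  repeat' with_reducible first
    | apply primrec_cons
    | apply Primrec.pair
    | apply primrec_satAtom | apply primrec_eqAtom | apply primrec_tupAtom
    | assumption
    | exact Primrec.const _
    | apply primrec_closure | apply primrec_witness | apply primrec_impCode
    | apply primrec_allCode | apply primrec_eqCode | apply primrec_leCode | apply primrec_relCode
    | apply primrec_varCode | apply primrec_fnCode
    | exact Primrec.list_append.comp h4 (primrec_cons h3 (Primrec.const []))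
    | exact Primrec.list_append.comp h4 (primrec_cons (primrec_witness h1 h2 h4) (Primrec.const []))
    | exact (Primrec.list_getD 0).comp h4 h1

/-- The properties of a truth assignment that express that it describes a term model. -/
structure DescribesModel (r₀ t₀ k : ℕ) (H : ℕ → Bool) : Prop where
  not_order : ¬ H (satAtom 0 k [])
  main : H (satAtom 1 t₀ [])
  falsum : ∀ s e, ¬ H (satAtom s 0 e)
  imp : ∀ s p q e, H (satAtom s (impCode p q) e) ↔ (H (satAtom s p e) → H (satAtom s q e))
  all : ∀ s p e, H (satAtom s (allCode p) e) → ∀ a, H (satAtom s p (e ++ [a]))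
  all_witness : ∀ s p e, H (satAtom s p (e ++ [witness s p e])) → H (satAtom s (allCode p) e)
  eq_refl : ∀ a, H (eqAtom a a)
  eq_trans : ∀ a b c, H (eqAtom a b) → H (eqAtom c b) → H (eqAtom a c)
  eq_var : ∀ i e, H (eqAtom (closure (varCode i) e) (e.getD i 0))
  tup_nil : ∀ e e', H (tupAtom [] e [] e')
  tup_cons : ∀ t s ts e ss e', H (eqAtom (closure t e) (closure s e')) →
    H (tupAtom ts e ss e') → H (tupAtom (t :: ts) e (s :: ss) e')
  eq_fn : ∀ f ts e ss e', H (tupAtom ts e ss e') →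
    H (eqAtom (closure (fnCode f ts) e) (closure (fnCode f ss) e'))
  sat_eq : ∀ t s e, H (satAtom 1 (eqCode t s) e) ↔ H (eqAtom (closure t e) (closure s e))
  sat_rel : ∀ r ts e ss e', H (tupAtom ts e ss e') → H (satAtom 1 (relCode r ts) e) →
    H (satAtom 1 (relCode r ss) e')
  order_eq : ∀ i j e, H (satAtom 0 (eqCode i j) e) ↔
    H (satAtom 1 (eqCode (varCode i) (varCode j)) e)
  order_le : ∀ i j e, H (satAtom 0 (leCode i j) e) ↔
    H (satAtom 1 (relCode r₀ [varCode i, varCode j]) e)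

theorem satisfies_nil {H : ℕ → Bool} : Satisfies H [] ↔ True := by simp [Satisfies]

theorem satisfies_cons {H : ℕ → Bool} {c : List (ℕ × Bool)} {cs : List (List (ℕ × Bool))} :
    Satisfies H (c :: cs) ↔ (∃ l ∈ c, H l.1 = l.2) ∧ Satisfies H cs := by simp [Satisfies]

theorem clause_nil {H : ℕ → Bool} : (∃ l ∈ ([] : List (ℕ × Bool)), H l.1 = l.2) ↔ False := by simp

theorem clause_cons {H : ℕ → Bool} {a : ℕ} {b : Bool} {c : List (ℕ × Bool)} :
    (∃ l ∈ (a, b) :: c, H l.1 = l.2) ↔ H a = b ∨ ∃ l ∈ c, H l.1 = l.2 := by simp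

theorem satisfies_modelClauses_iff {r₀ t₀ k : ℕ} {H : ℕ → Bool} :
    (∀ x, Satisfies H (modelClauses r₀ t₀ k x)) ↔ DescribesModel r₀ t₀ k H := by
  simp only [modelClauses, satisfies_cons, clause_cons, clause_nil, satisfies_nil, or_false,
    and_true, ← Bool.not_eq_true, forall_and]
  constructor
  · rintro ⟨c0, c1, c2, c3, c4, c5, c6, c7, c8, c9, c10, c11, c12, c13, c14, c15, c16, c17, c18, c19,
      c20⟩
    have imp' : ∀ {p q : Prop}, ¬ p ∨ q → p → q := fun h hp => h.resolve_left (not_not.2 hp)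
    exact {
      not_order := c0 default
      main := c1 default
      falsum := fun s e => c2 ((s, 0, 0), e, [], [], [])
      imp := fun s p q e => by
        have h3 := c3 ((s, p, q), e, [], [], [])
        have h4 := c4 ((s, p, q), e, [], [], [])
        have h5 := c5 ((s, p, q), e, [], [], [])
        dsimp only at h3 h4 h5
        tauto
      all := fun s p e h a => imp' (c6 ((s, p, a), e, [], [], [])) h
      all_witness := fun s p e => imp' (c7 ((s, p, 0), e, [], [], [])).symm
      eq_refl := fun a => c8 ((a, 0, 0), [], [], [], [])
      eq_trans := fun a b c h h' => imp' (imp' (c9 ((a, b, c), [], [], [], [])) h) h'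
      eq_var := fun i e => c10 ((i, 0, 0), e, [], [], [])
      tup_nil := fun e e' => c11 (default, e, e', [], [])
      tup_cons := fun t s ts e ss e' h h' => imp' (imp' (c12 ((t, s, 0), e, e', ts, ss)) h) h'
      eq_fn := fun f ts e ss e' => imp' (c13 ((f, 0, 0), e, e', ts, ss))
      sat_eq := fun t s e => ⟨imp' (c14 ((t, s, 0), e, [], [], [])),
        imp' (c15 ((t, s, 0), e, [], [], [])).symm⟩
      sat_rel := fun r ts e ss e' h h' => imp' (imp' (c16 ((r, 0, 0), e, e', ts, ss)) h) h'
      order_eq := fun i j e => ⟨imp' (c17 ((i, j, 0), e, [], [], [])),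
        imp' (c18 ((i, j, 0), e, [], [], [])).symm⟩
      order_le := fun i j e => ⟨imp' (c19 ((i, j, 0), e, [], [], [])),
        imp' (c20 ((i, j, 0), e, [], [], [])).symm⟩ }
  · intro h
    have or' : ∀ {p q : Prop}, (p → q) → ¬ p ∨ q := fun h => or_iff_not_imp_left.2 fun hp =>
      h (not_not.1 hp)
    refine ⟨fun _ => h.not_order, fun _ => h.main, fun x => h.falsum _ _, fun x => ?_, fun x => ?_,
      fun x => ?_, fun x => or' fun h' => h.all _ _ _ h' _, fun x => (or' (h.all_witness _ _ _)).symm,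
      fun x => h.eq_refl _, fun x => or' fun h1 => or' fun h2 => h.eq_trans _ _ _ h1 h2,
      fun x => h.eq_var _ _, fun x => h.tup_nil _ _,
      fun x => or' fun h1 => or' fun h2 => h.tup_cons _ _ _ _ _ _ h1 h2,
      fun x => or' (h.eq_fn _ _ _ _ _), fun x => or' (h.sat_eq _ _ _).1,
      fun x => (or' (h.sat_eq _ _ _).2).symm,
      fun x => or' fun h1 => or' fun h2 => h.sat_rel _ _ _ _ _ h1 h2,
      fun x => or' (h.order_eq _ _ _).1, fun x => (or' (h.order_eq _ _ _).2).symm,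
      fun x => or' (h.order_le _ _ _).1, fun x => (or' (h.order_le _ _ _).2).symm⟩ <;>
    · rw [h.imp]
      tauto

end YoungLattice

namespace YoungLattice

/-! ### Codes of formulas of an arbitrary language -/

section Codes

variable {K : FirstOrder.Language.{u, v}} (num : K.Symbols → ℕ)

/-- The code of a term, given a numbering of the symbols. -/
def symTermCode {n : ℕ} : K.Term (Empty ⊕ Fin n) → ℕ
  | .var (.inl e) => e.elim
  | .var (.inr i) => varCode i
  | .func f ts => fnCode (num (.inl ⟨_, f⟩)) (List.ofFn fun i => symTermCode (ts i))

/-- The code of a formula, given a numbering of the symbols. -/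
def symFormulaCode : ∀ {n : ℕ}, K.BoundedFormula Empty n → ℕ
  | _, .falsum => 0
  | _, .equal t s => eqCode (symTermCode num t) (symTermCode num s)
  | _, .rel R ts => relCode (num (.inr ⟨_, R⟩)) (List.ofFn fun i => symTermCode num (ts i))
  | _, .imp p q => impCode (symFormulaCode p) (symFormulaCode q)
  | _, .all p => allCode (symFormulaCode p)

/-- The function symbols of a term. -/
def termSymbols {α : Type} : K.Term α → Set K.Symbols
  | .var _ => ∅
  | .func f ts => insert (.inl ⟨_, f⟩) (⋃ i, termSymbols (ts i))

/-- The symbols of a formula. -/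
def formulaSymbols : ∀ {n : ℕ}, K.BoundedFormula Empty n → Set K.Symbols
  | _, .falsum => ∅
  | _, .equal t s => termSymbols t ∪ termSymbols s
  | _, .rel R ts => insert (.inr ⟨_, R⟩) (⋃ i, termSymbols (ts i))
  | _, .imp p q => formulaSymbols p ∪ formulaSymbols q
  | _, .all p => formulaSymbols p

theorem finite_termSymbols {α : Type} (t : K.Term α) : (termSymbols t).Finite := by
  induction t with
  | var => exact Set.finite_empty
  | func f ts ih => exact (Set.finite_iUnion ih).insert _

theorem finite_formulaSymbols {n : ℕ} (p : K.BoundedFormula Empty n) :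
    (formulaSymbols p).Finite := by
  induction p with
  | falsum => exact Set.finite_empty
  | equal t s => exact (finite_termSymbols t).union (finite_termSymbols s)
  | rel R ts => exact (Set.finite_iUnion fun i => finite_termSymbols (ts i)).insert _
  | imp p q hp hq => exact hp.union hq
  | all p hp => exact hp

/-- A predicate on codes of formulas and lists of elements that obeys Tarski's conditions expresses
satisfaction if it does so for atomic formulas. -/
theorem iff_realize_of_tarski {X Q : Type*} [K.Structure Q] {π : X → Q}
    (hπ : Function.Surjective π) {code : ∀ {n : ℕ}, K.BoundedFormula Empty n → ℕ}
    {S : ℕ → List X → Prop}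
    (hfalsum : ∀ {n : ℕ} e, ¬ S (code (.falsum : K.BoundedFormula Empty n)) e)
    (himp : ∀ {n : ℕ} (p q : K.BoundedFormula Empty n) e,
      S (code (p.imp q)) e ↔ (S (code p) e → S (code q) e))
    (hall : ∀ {n : ℕ} (p : K.BoundedFormula Empty (n + 1)) e,
      S (code p.all) e ↔ ∀ a, S (code p) (e ++ [a]))
    {A : Set K.Symbols} {v : Empty → Q}
    (hequal : ∀ {n : ℕ} (t s : K.Term (Empty ⊕ Fin n)) (e : Fin n → X), termSymbols t ⊆ A →
      termSymbols s ⊆ A → (S (code (.equal t s)) (List.ofFn e) ↔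
        t.realize (Sum.elim v (π ∘ e)) = s.realize (Sum.elim v (π ∘ e))))
    (hrel : ∀ {n l : ℕ} (R : K.Relations l) (ts : Fin l → K.Term (Empty ⊕ Fin n)) (e : Fin n → X),
      formulaSymbols (.rel R ts) ⊆ A → (S (code (.rel R ts)) (List.ofFn e) ↔
        Language.Structure.RelMap R fun i => (ts i).realize (Sum.elim v (π ∘ e))))
    {n : ℕ} (p : K.BoundedFormula Empty n) (e : Fin n → X) (hp : formulaSymbols p ⊆ A) :
    S (code p) (List.ofFn e) ↔ p.Realize v (π ∘ e) := by
  induction p with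
  | falsum => exact iff_of_false (hfalsum _) id
  | equal t s =>
    exact hequal t s e (Set.subset_union_left.trans hp)
      (Set.subset_union_right.trans hp)
  | rel R ts => exact hrel R ts e hp
  | imp p q ihp ihq =>
    rw [himp, Language.BoundedFormula.realize_imp, ihp e (Set.subset_union_left.trans hp),
      ihq e (Set.subset_union_right.trans hp)]
  | all p ih =>
    rw [hall, Language.BoundedFormula.realize_all, hπ.forall]
    refine forall_congr' fun a => ?_
    rw [← Fin.comp_snoc, ← ih _ hp]
    rw [List.ofFn_succ', List.concat_eq_append]
    simp only [Fin.snoc_castSucc, Fin.snoc_last]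

end Codes

/-! ### From truth assignments to models -/

namespace DescribesModel

variable {r₀ t₀ k : ℕ} {H : ℕ → Bool}

/-- Equality in the term model. -/
def setoid (h : DescribesModel r₀ t₀ k H) : Setoid ℕ where
  r a b := H (eqAtom a b)
  iseqv := by
    -- `eq_trans` infers a = c from a = b and c = b; in this form it also yields symmetry from
    -- reflexivity.
    have symm : ∀ {a b}, H (eqAtom a b) → H (eqAtom b a) := fun {a b} hab =>
      h.eq_trans b b a (h.eq_refl b) hab
    exact ⟨h.eq_refl, symm, fun hab hbc => h.eq_trans _ _ _ hab (symm hbc)⟩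

theorem tup_ofFn (h : DescribesModel r₀ t₀ k H) {l : ℕ} {ts ss : Fin l → ℕ} {e e' : List ℕ}
    (hts : ∀ i, H (eqAtom (closure (ts i) e) (closure (ss i) e'))) :
    H (tupAtom (List.ofFn ts) e (List.ofFn ss) e') := by
  induction l with
  | zero => simpa using h.tup_nil e e'
  | succ l ih =>
    rw [List.ofFn_succ, List.ofFn_succ]
    exact h.tup_cons _ _ _ _ _ _ (hts 0) (ih fun i => hts i.succ)

variable {K : FirstOrder.Language.{u, v}} (num : K.Symbols → ℕ)

/-- The term model. -/
@[reducible]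
noncomputable def termModel (h : DescribesModel r₀ t₀ k H) : K.Structure (Quotient h.setoid) where
  funMap {n} f xs := Quotient.mk _ <|
    closure (fnCode (num (.inl ⟨n, f⟩)) (List.ofFn fun i : Fin n => varCode i))
      (List.ofFn fun i => (xs i).out)
  RelMap {n} R xs := H <|
    satAtom 1 (relCode (num (.inr ⟨n, R⟩)) (List.ofFn fun i : Fin n => varCode i))
      (List.ofFn fun i => (xs i).out)

theorem eq_var_ofFn (h : DescribesModel r₀ t₀ k H) {n : ℕ} (e : Fin n → ℕ) (i : Fin n) :
    H (eqAtom (closure (varCode i) (List.ofFn e)) (e i)) := by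
  have := h.eq_var i (List.ofFn e)
  simpa using this

/-- A tuple of terms agrees with the tuple of variables evaluated at representatives of the
values of the terms. -/
theorem tup_out (h : DescribesModel r₀ t₀ k H) {l : ℕ} (ts : Fin l → ℕ) (e : List ℕ) :
    H (tupAtom (List.ofFn fun i : Fin l => varCode i)
      (List.ofFn fun i => (Quotient.mk h.setoid (closure (ts i) e)).out) (List.ofFn ts) e) :=
  h.tup_ofFn fun i => h.setoid.trans (h.eq_var_ofFn _ i) (Quotient.mk_out (s := h.setoid) _)

theorem tup_out' (h : DescribesModel r₀ t₀ k H) {l : ℕ} (ts : Fin l → ℕ) (e : List ℕ) :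
    H (tupAtom (List.ofFn ts) e (List.ofFn fun i : Fin l => varCode i)
      (List.ofFn fun i => (Quotient.mk h.setoid (closure (ts i) e)).out)) :=
  h.tup_ofFn fun i => h.setoid.symm
    (h.setoid.trans (h.eq_var_ofFn _ i) (Quotient.mk_out (s := h.setoid) _))

/-- The term model applies f by evaluating f(x₀, x₁, …) at chosen representatives. By `tup_out` and
`eq_fn` this agrees with the code of f applied to the argument terms themselves. -/
theorem realize_term (h : DescribesModel r₀ t₀ k H) {n : ℕ} (t : K.Term (Empty ⊕ Fin n))
    (v : Empty → Quotient h.setoid) (e : Fin n → ℕ) :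
    letI := h.termModel num
    t.realize (Sum.elim v (Quotient.mk h.setoid ∘ e)) =
      Quotient.mk h.setoid (closure (symTermCode num t) (List.ofFn e)) := by
  let := h.termModel num
  induction t with
  | var i =>
    rcases i with i | i
    · exact i.elim
    · exact (Quotient.sound (s := h.setoid) (h.eq_var_ofFn e i)).symm
  | func f ts ih =>
    rw [Language.Term.realize_func]
    simp only [ih]
    exact Quotient.sound (s := h.setoid) (h.eq_fn _ _ _ _ _ (h.tup_out _ _))

theorem relMap_iff (h : DescribesModel r₀ t₀ k H) {l : ℕ} (R : K.Relations l) (ts : Fin l → ℕ)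
    (e : List ℕ) :
    letI := h.termModel num
    Language.Structure.RelMap R (fun i => Quotient.mk h.setoid (closure (ts i) e)) ↔
      H (satAtom 1 (relCode (num (.inr ⟨l, R⟩)) (List.ofFn ts)) e) :=
  ⟨h.sat_rel _ _ _ _ _ (h.tup_out _ _), h.sat_rel _ _ _ _ _ (h.tup_out' _ _)⟩

/-- The Henkin witness is a counterexample whenever there is one, so truth at it alone gives the
universal formula. -/
theorem all_iff (h : DescribesModel r₀ t₀ k H) (s p : ℕ) (e : List ℕ) :
    H (satAtom s (allCode p) e) ↔ ∀ a, H (satAtom s p (e ++ [a])) :=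
  ⟨h.all s p e, fun h' => h.all_witness s p e (h' _)⟩

theorem sat_iff_realize (h : DescribesModel r₀ t₀ k H) {n : ℕ} (p : K.BoundedFormula Empty n)
    (v : Empty → Quotient h.setoid) (e : Fin n → ℕ) :
    letI := h.termModel num
    H (satAtom 1 (symFormulaCode num p) (List.ofFn e)) ↔ p.Realize v (Quotient.mk h.setoid ∘ e) := by
  let := h.termModel num
  refine iff_realize_of_tarski (A := Set.univ) (code := fun {n} => symFormulaCode num (n := n))
    (S := fun p e => H (satAtom 1 p e)) Quotient.mk_surjective
    (fun e => h.falsum 1 e) (fun p q e => h.imp 1 _ _ e) (fun p e => h.all_iff 1 _ e)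
    (fun t s e _ _ => ?_) (fun R ts e _ => ?_) p e (Set.subset_univ _)
  · rw [h.realize_term num, h.realize_term num]
    exact (h.sat_eq _ _ _).trans (Quotient.eq (r := h.setoid)).symm
  · simp only [h.realize_term num]
    exact (h.relMap_iff num R _ _).symm

theorem order_sat_iff_realize (h : DescribesModel r₀ t₀ k H) (φ : Language.order →ᴸ K)
    (hr₀ : r₀ = num (.inr ⟨2, φ.onRelation Language.leSymb⟩)) {n : ℕ}
    (p : Language.order.BoundedFormula Empty n) (v : Empty → Quotient h.setoid) (e : Fin n → ℕ) :
    letI := h.termModel num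
    letI := φ.reduct (Quotient h.setoid)
    H (satAtom 0 (formulaCode p) (List.ofFn e)) ↔ p.Realize v (Quotient.mk h.setoid ∘ e) := by
  let := h.termModel num
  let := φ.reduct (Quotient h.setoid)
  have hvar : ∀ {n : ℕ} (t : Language.order.Term (Empty ⊕ Fin n)) (e : Fin n → ℕ),
      t.realize (Sum.elim v (Quotient.mk h.setoid ∘ e)) =
        Quotient.mk h.setoid (closure (varCode (termCode t)) (List.ofFn e)) := by
    intro n t e
    match t with
    | .var (.inl i) => exact i.elim
    | .var (.inr i) => exact (Quotient.sound (s := h.setoid) (h.eq_var_ofFn e i)).symm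
    | .func f _ => exact Empty.elim f
  refine iff_realize_of_tarski (A := Set.univ) (code := fun {n} => formulaCode (n := n))
    (S := fun p e => H (satAtom 0 p e)) Quotient.mk_surjective
    (fun e => h.falsum 0 e) (fun p q e => h.imp 0 _ _ e) (fun p e => h.all_iff 0 _ e)
    (fun t s e _ _ => ?_) (fun {n l} R ts e _ => ?_) p e (Set.subset_univ _)
  · rw [hvar, hvar]
    exact ((h.order_eq _ _ _).trans (h.sat_eq _ _ _)).trans (Quotient.eq (r := h.setoid)).symm
  · simp only [hvar]
    match l, R with
    | 2, .le =>
      refine (h.order_le _ _ _).trans (Iff.trans ?_ (h.relMap_iff num _ _ _).symm)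
      rw [hr₀]
      simp [List.ofFn_succ]
      rfl

end DescribesModel

/-- Distinct symbols need not have distinct numbers here: symbols of the same kind, arity and number
just receive the same interpretation. The sentences are evaluated at the empty tuple. -/
theorem exists_model_of_describesModel {K : FirstOrder.Language.{u, v}} (num : K.Symbols → ℕ)
    (φ : Language.order →ᴸ K) (τ : K.Sentence) (σ : Language.order.Sentence) {H : ℕ → Bool}
    (h : DescribesModel (num (.inr ⟨2, φ.onRelation Language.leSymb⟩)) (symFormulaCode num τ)
      (formulaCode σ) H) :
    ∃ (Q : Type) (_ : K.Structure Q), Nonempty Q ∧ Q ⊨ τ ∧ ¬ Q ⊨ φ.onSentence σ := by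
  let := h.termModel num
  let := φ.reduct (Quotient h.setoid)
  refine ⟨Quotient h.setoid, h.termModel num, ⟨Quotient.mk _ 0⟩, ?_, ?_⟩
  · have := (h.sat_iff_realize num τ (@default _ Unique.instInhabited) Fin.elim0).1
      (by simpa using h.main)
    rwa [Subsingleton.elim (Quotient.mk h.setoid ∘ Fin.elim0) (@default _ Unique.instInhabited)]
      at this
  · rw [Language.LHom.realize_onSentence]
    intro hσ
    refine h.not_order ?_
    have := (h.order_sat_iff_realize num φ rfl σ (@default _ Unique.instInhabited) Fin.elim0).2 (by
      rwa [Subsingleton.elim (Quotient.mk h.setoid ∘ Fin.elim0) (@default _ Unique.instInhabited)])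
    simpa using this

end YoungLattice

namespace YoungLattice

/-! ### From models to truth assignments -/

open Encodable (encode)
open Denumerable (ofNat)

theorem lt_encode_of_mem {x : ℕ} {l : List ℕ} (h : x ∈ l) : x < encode l := by
  induction l with
  | nil => simp at h
  | cons a l ih =>
    rw [Encodable.encode_list_cons, Nat.lt_succ_iff]
    rcases List.mem_cons.1 h with rfl | h
    · exact Nat.left_le_pair _ _
    · exact (ih h).le.trans (Nat.right_le_pair _ _)

theorem lt_of_mem_ofNat {x n : ℕ} (h : x ∈ ofNat (List ℕ) n) : x < n := by
  simpa using lt_encode_of_mem h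

/-- Interpretations of numbered function and relation symbols in a set, with a distinguished
relation and a distinguished element. -/
structure Interpretation (M : Type w) where
  /-- the interpretation of the function symbols -/
  fn : ℕ → List M → M
  /-- the interpretation of the relation symbols -/
  rel : ℕ → List M → Prop
  /-- the number of the symbol `≤` -/
  ord : ℕ
  /-- the default element -/
  dflt : M

namespace Interpretation

variable {M : Type w} (I : Interpretation M)

/-- The value of a coded term. -/
def termVal (t : ℕ) (m : List M) : M :=
  if t.unpair.1 = 0 then m.getD t.unpair.2 I.dflt
  else I.fn (t.unpair.1 - 1) ((ofNat (List ℕ) t.unpair.2).attach.map fun s => termVal s.1 m)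
termination_by t
decreasing_by
  exact (lt_of_mem_ofNat s.2).trans_le (Nat.unpair_right_le t)

theorem termVal_varCode (i : ℕ) (m : List M) : I.termVal (varCode i) m = m.getD i I.dflt := by
  rw [termVal]; simp [varCode]

theorem termVal_fnCode (f : ℕ) (ts : List ℕ) (m : List M) :
    I.termVal (fnCode f ts) m = I.fn f (ts.map fun s => I.termVal s m) := by
  rw [termVal]; simp [fnCode]

/-- Satisfaction of a coded formula. -/
def SatVal (s : ℕ) : ℕ → List M → Prop
  | 0, _ => False
  | q + 1, m =>
    -- The argument is q + 1, so the residue of q modulo 4 tells the form of the coded formula: 0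
    -- for an equation, 1 for a relation, 2 for an implication, 3 for a universal quantifier.
    if q % 4 = 0 then
      if s = 0 then m.getD (q / 4).unpair.1 I.dflt = m.getD (q / 4).unpair.2 I.dflt
      else I.termVal (q / 4).unpair.1 m = I.termVal (q / 4).unpair.2 m
    else if q % 4 = 1 then
      if s = 0 then I.rel I.ord [m.getD (q / 4).unpair.1 I.dflt, m.getD (q / 4).unpair.2 I.dflt]
      else I.rel (q / 4).unpair.1 ((ofNat (List ℕ) (q / 4).unpair.2).map fun t => I.termVal t m)
    else if q % 4 = 2 then SatVal s (q / 4).unpair.1 m → SatVal s (q / 4).unpair.2 m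
    else ∀ a, SatVal s (q / 4) (m ++ [a])
termination_by p => p
decreasing_by
  · have := Nat.unpair_left_le (q / 4); omega
  · have := Nat.unpair_right_le (q / 4); omega
  · omega

theorem satVal_falsum (s : ℕ) (m : List M) : ¬ I.SatVal s 0 m := by
  rw [SatVal]; exact id

theorem satVal_impCode (s p q : ℕ) (m : List M) :
    I.SatVal s (impCode p q) m ↔ (I.SatVal s p m → I.SatVal s q m) := by
  rw [impCode, SatVal, if_neg (by omega), if_neg (by omega), if_pos (by omega),
    show (4 * Nat.pair p q + 2) / 4 = Nat.pair p q by omega]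
  simp

theorem satVal_allCode (s p : ℕ) (m : List M) :
    I.SatVal s (allCode p) m ↔ ∀ a, I.SatVal s p (m ++ [a]) := by
  rw [allCode, SatVal, if_neg (by omega), if_neg (by omega), if_neg (by omega),
    show (4 * p + 3) / 4 = p by omega]

theorem satVal_eqCode (t s : ℕ) (m : List M) :
    I.SatVal 1 (eqCode t s) m ↔ I.termVal t m = I.termVal s m := by
  rw [eqCode, SatVal, if_pos (by omega), show 4 * Nat.pair t s / 4 = Nat.pair t s by omega]
  simp

theorem satVal_relCode (r : ℕ) (ts : List ℕ) (m : List M) :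
    I.SatVal 1 (relCode r ts) m ↔ I.rel r (ts.map fun t => I.termVal t m) := by
  rw [relCode, SatVal, if_neg (by omega), if_pos (by omega),
    show (4 * Nat.pair r (encode ts) + 1) / 4 = Nat.pair r (encode ts) by omega]
  simp

theorem satVal_order_eqCode (i j : ℕ) (m : List M) :
    I.SatVal 0 (eqCode i j) m ↔ m.getD i I.dflt = m.getD j I.dflt := by
  rw [eqCode, SatVal, if_pos (by omega), show 4 * Nat.pair i j / 4 = Nat.pair i j by omega]
  simp

theorem satVal_order_leCode (i j : ℕ) (m : List M) :
    I.SatVal 0 (leCode i j) m ↔ I.rel I.ord [m.getD i I.dflt, m.getD j I.dflt] := by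
  rw [leCode, SatVal, if_neg (by omega), if_pos (by omega),
    show (4 * Nat.pair i j + 1) / 4 = Nat.pair i j by omega]
  simp

open Classical in
/-- A counterexample to a universally quantified formula. -/
noncomputable def skolem (s p : ℕ) (m : List M) : M :=
  if h : ∃ a, ¬ I.SatVal s p (m ++ [a]) then h.choose else I.dflt

theorem satVal_of_skolem {s p : ℕ} {m : List M} (h : I.SatVal s p (m ++ [I.skolem s p m])) (a : M) :
    I.SatVal s p (m ++ [a]) := by
  by_contra ha
  have hex : ∃ a, ¬ I.SatVal s p (m ++ [a]) := ⟨a, ha⟩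
  rw [skolem, dif_pos hex] at h
  exact hex.choose_spec h

/-- The value of an element of the term model. -/
noncomputable def elemVal (a : ℕ) : M :=
  if a % 2 = 0 then
    I.termVal (a / 2).unpair.1 ((ofNat (List ℕ) (a / 2).unpair.2).attach.map fun b => elemVal b.1)
  else I.skolem (a / 2).unpair.1 (a / 2).unpair.2.unpair.1
    ((ofNat (List ℕ) (a / 2).unpair.2.unpair.2).attach.map fun b => elemVal b.1)
termination_by a
decreasing_by
  all_goals
    have h1 := lt_of_mem_ofNat b.2
    have h2 := Nat.unpair_right_le (a / 2)
    have h3 := Nat.unpair_right_le (a / 2).unpair.2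
    omega

theorem elemVal_closure (t : ℕ) (e : List ℕ) :
    I.elemVal (closure t e) = I.termVal t (e.map I.elemVal) := by
  rw [elemVal, closure, if_pos (by omega),
    show 2 * Nat.pair t (encode e) / 2 = Nat.pair t (encode e) by omega]
  simp

theorem elemVal_witness (s p : ℕ) (e : List ℕ) :
    I.elemVal (witness s p e) = I.skolem s p (e.map I.elemVal) := by
  rw [elemVal, witness, if_neg (by omega), show (2 * Nat.pair s (Nat.pair p (encode e)) + 1) / 2 =
    Nat.pair s (Nat.pair p (encode e)) by omega]
  simp

/-- The number 0 is itself the code of the variable x₀ at the empty tuple. Out-of-range variables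
thus get matching defaults in the term model and in the interpretation, as `getD_map_elemVal`
requires. -/
theorem elemVal_zero : I.elemVal 0 = I.dflt := by
  rw [show 0 = closure (varCode 0) [] from rfl, elemVal_closure, termVal_varCode]
  rfl

open Classical in
/-- The truth assignment describing an interpretation. -/
noncomputable def assignment (n : ℕ) : Bool :=
  if n % 3 = 0 then decide (I.SatVal (n / 3).unpair.1 (n / 3).unpair.2.unpair.1
    ((ofNat (List ℕ) (n / 3).unpair.2.unpair.2).map I.elemVal))
  else if n % 3 = 1 then decide (I.elemVal (n / 3).unpair.1 = I.elemVal (n / 3).unpair.2)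
  else decide (
    (ofNat (List ℕ) (n / 3).unpair.1.unpair.1).map (fun t => I.termVal t
      ((ofNat (List ℕ) (n / 3).unpair.1.unpair.2).map I.elemVal)) =
    (ofNat (List ℕ) (n / 3).unpair.2.unpair.1).map (fun t => I.termVal t
      ((ofNat (List ℕ) (n / 3).unpair.2.unpair.2).map I.elemVal)))

theorem assignment_satAtom (s p : ℕ) (e : List ℕ) :
    I.assignment (satAtom s p e) ↔ I.SatVal s p (e.map I.elemVal) := by
  rw [assignment, satAtom, if_pos (by omega), show 3 * Nat.pair s (Nat.pair p (encode e)) / 3 =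
    Nat.pair s (Nat.pair p (encode e)) by omega]
  simp

theorem assignment_eqAtom (a b : ℕ) : I.assignment (eqAtom a b) ↔ I.elemVal a = I.elemVal b := by
  rw [assignment, eqAtom, if_neg (by omega), if_pos (by omega),
    show (3 * Nat.pair a b + 1) / 3 = Nat.pair a b by omega]
  simp

theorem assignment_tupAtom (ts e ss e' : List ℕ) : I.assignment (tupAtom ts e ss e') ↔
    ts.map (fun t => I.termVal t (e.map I.elemVal)) =
      ss.map (fun t => I.termVal t (e'.map I.elemVal)) := by
  rw [assignment, tupAtom, if_neg (by omega), if_neg (by omega)]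
  generalize hA : Nat.pair (encode ts) (encode e) = a
  generalize hB : Nat.pair (encode ss) (encode e') = b
  rw [show (3 * Nat.pair a b + 2) / 3 = Nat.pair a b by omega]
  simp [← hA, ← hB]

theorem getD_map_elemVal (e : List ℕ) (i : ℕ) :
    (e.map I.elemVal).getD i I.dflt = I.elemVal (e.getD i 0) := by
  rw [← elemVal_zero, List.getD_map]

/-- Every number used as an element of the term model has a value in the given interpretation,
Henkin witnesses being sent to Skolem choices, and each clause is a fact about these values. -/
theorem describesModel {t₀ k : ℕ} (ht₀ : I.SatVal 1 t₀ []) (hk : ¬ I.SatVal 0 k []) :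
    DescribesModel I.ord t₀ k I.assignment where
  not_order := by rwa [assignment_satAtom]
  main := by rwa [assignment_satAtom]
  falsum s e := by rw [assignment_satAtom]; exact I.satVal_falsum _ _
  imp s p q e := by simp only [assignment_satAtom, satVal_impCode]
  all s p e h a := by
    rw [assignment_satAtom, satVal_allCode] at h
    rw [assignment_satAtom, List.map_append]
    exact h _
  all_witness s p e h := by
    rw [assignment_satAtom, satVal_allCode]
    rw [assignment_satAtom, List.map_append, List.map_singleton, elemVal_witness] at h
    exact I.satVal_of_skolem h
  eq_refl a := by rw [assignment_eqAtom]
  eq_trans a b c h h' := by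
    rw [assignment_eqAtom] at *
    exact h.trans h'.symm
  eq_var i e := by rw [assignment_eqAtom, elemVal_closure, termVal_varCode, getD_map_elemVal]
  tup_nil e e' := by rw [assignment_tupAtom]; rfl
  tup_cons t s ts e ss e' h h' := by
    rw [assignment_eqAtom, elemVal_closure, elemVal_closure] at h
    rw [assignment_tupAtom] at h' ⊢
    rw [List.map_cons, List.map_cons, h, h']
  eq_fn f ts e ss e' h := by
    rw [assignment_tupAtom] at h
    rw [assignment_eqAtom, elemVal_closure, elemVal_closure, termVal_fnCode, termVal_fnCode, h]
  sat_eq t s e := by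
    rw [assignment_satAtom, assignment_eqAtom, elemVal_closure, elemVal_closure, satVal_eqCode]
  sat_rel r ts e ss e' h h' := by
    rw [assignment_tupAtom] at h
    rw [assignment_satAtom, satVal_relCode] at h' ⊢
    rwa [← h]
  order_eq i j e := by
    rw [assignment_satAtom, assignment_satAtom, satVal_order_eqCode, satVal_eqCode,
      termVal_varCode, termVal_varCode]
  order_le i j e := by
    rw [assignment_satAtom, assignment_satAtom, satVal_order_leCode, satVal_relCode]
    simp only [List.map_cons, List.map_nil, termVal_varCode]

end Interpretation

section OfStructure

variable {K : FirstOrder.Language.{u, v}} {M : Type w} [K.Structure M] (num : K.Symbols → ℕ)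
  (A : Set K.Symbols)

open Classical in
/-- The interpretation of the numbers of some of the symbols of a language given by a structure. -/
noncomputable def interpretationOfStructure (d : M) (r₀ : ℕ) : Interpretation M where
  fn f l := if h : ∃ a, ∃ (n : ℕ) (F : K.Functions n) (xs : Fin n → M), .inl ⟨n, F⟩ ∈ A ∧
    num (.inl ⟨n, F⟩) = f ∧ List.ofFn xs = l ∧ Language.Structure.funMap F xs = a then h.choose else d
  rel r l := ∃ (n : ℕ) (R : K.Relations n) (xs : Fin n → M), .inr ⟨n, R⟩ ∈ A ∧
    num (.inr ⟨n, R⟩) = r ∧ List.ofFn xs = l ∧ Language.Structure.RelMap R xs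
  ord := r₀
  dflt := d

variable {num A}

/-- Injectivity of the numbering on `A` makes the symbol, and with it the chosen value, unique. -/
theorem fn_interpretation (hA : Set.InjOn num A) (d : M) (r₀ : ℕ) {n : ℕ} {F : K.Functions n} (hF : .inl ⟨n, F⟩ ∈ A) (xs : Fin n → M) :
    (interpretationOfStructure num A d r₀).fn (num (.inl ⟨n, F⟩)) (List.ofFn xs) =
      Language.Structure.funMap F xs := by
  have hex : ∃ a, ∃ (n' : ℕ) (F' : K.Functions n') (xs' : Fin n' → M), .inl ⟨n', F'⟩ ∈ A ∧
      num (.inl ⟨n', F'⟩) = num (.inl ⟨n, F⟩) ∧ List.ofFn xs' = List.ofFn xs ∧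
        Language.Structure.funMap F' xs' = a := ⟨_, n, F, xs, hF, rfl, rfl, rfl⟩
  refine (dif_pos hex).trans ?_
  obtain ⟨n', F', xs', hF', h1, h2, h3⟩ := hex.choose_spec
  rw [← h3]
  have := hA hF' hF h1
  simp only [Sum.inl.injEq, Sigma.mk.injEq] at this
  obtain ⟨rfl, h⟩ := this
  obtain rfl := eq_of_heq h
  rw [List.ofFn_injective h2]

theorem rel_interpretation (hA : Set.InjOn num A) (d : M) (r₀ : ℕ) {n : ℕ} {R : K.Relations n} (hR : .inr ⟨n, R⟩ ∈ A) (xs : Fin n → M) :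
    (interpretationOfStructure num A d r₀).rel (num (.inr ⟨n, R⟩)) (List.ofFn xs) ↔
      Language.Structure.RelMap R xs := by
  refine ⟨?_, fun h => ⟨n, R, xs, hR, rfl, rfl, h⟩⟩
  rintro ⟨n', R', xs', hR', h1, h2, h3⟩
  have := hA hR' hR h1
  simp only [Sum.inr.injEq, Sigma.mk.injEq] at this
  obtain ⟨rfl, h⟩ := this
  obtain rfl := eq_of_heq h
  rwa [← List.ofFn_injective h2]

theorem termVal_interpretation (hA : Set.InjOn num A) (d : M) (r₀ : ℕ) {n : ℕ} (t : K.Term (Empty ⊕ Fin n)) (ht : termSymbols t ⊆ A)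
    (v : Empty → M) (e : Fin n → M) :
    (interpretationOfStructure num A d r₀).termVal (symTermCode num t) (List.ofFn e) =
      t.realize (Sum.elim v e) := by
  induction t with
  | var i =>
    rcases i with i | i
    · exact i.elim
    · simp [symTermCode, Interpretation.termVal_varCode]
  | func f ts ih =>
    have h1 : .inl ⟨_, f⟩ ∈ A := ht (Set.mem_insert _ _)
    have h2 : ∀ i, termSymbols (ts i) ⊆ A := fun i =>
      (Set.subset_iUnion (fun i => termSymbols (ts i)) i).trans
        ((Set.subset_insert _ _).trans ht)
    rw [symTermCode, Interpretation.termVal_fnCode, List.map_ofFn, Language.Term.realize_func,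
      ← fn_interpretation hA d r₀ h1]
    congr 2
    funext i
    exact ih i (h2 i)

theorem satVal_interpretation (hA : Set.InjOn num A) (d : M) (r₀ : ℕ) {n : ℕ} (p : K.BoundedFormula Empty n) (hp : formulaSymbols p ⊆ A)
    (v : Empty → M) (e : Fin n → M) :
    (interpretationOfStructure num A d r₀).SatVal 1 (symFormulaCode num p) (List.ofFn e) ↔
      p.Realize v e := by
  refine iff_realize_of_tarski (π := id) (code := fun {n} => symFormulaCode num (n := n))
    (S := (interpretationOfStructure num A d r₀).SatVal 1) Function.surjective_id
    (fun e => Interpretation.satVal_falsum _ 1 e)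
    (fun p q e => Interpretation.satVal_impCode _ 1 _ _ e)
    (fun p e => Interpretation.satVal_allCode _ 1 _ e)
    (fun t s e ht hs => ?_) (fun R ts e hR => ?_) p e hp
  · refine (Interpretation.satVal_eqCode _ _ _ _).trans ?_
    rw [termVal_interpretation hA d r₀ t ht v, termVal_interpretation hA d r₀ s hs v]
    rfl
  · have h1 : .inr ⟨_, R⟩ ∈ A := hR (Set.mem_insert _ _)
    have h2 : ∀ i, termSymbols (ts i) ⊆ A := fun i =>
      (Set.subset_iUnion (fun i => termSymbols (ts i)) i).trans
        ((Set.subset_insert _ _).trans hR)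
    refine (Interpretation.satVal_relCode _ _ _ _).trans ?_
    rw [List.map_ofFn, ← rel_interpretation hA d r₀ h1]
    refine iff_of_eq (congrArg _ (congrArg _ (funext fun i => ?_)))
    exact termVal_interpretation hA d r₀ (ts i) (h2 i) v e

theorem order_satVal_interpretation (hA : Set.InjOn num A) (d : M) (φ : Language.order →ᴸ K)
    (hφ : .inr ⟨2, φ.onRelation Language.leSymb⟩ ∈ A) {n : ℕ}
    (p : Language.order.BoundedFormula Empty n) (v : Empty → M) (e : Fin n → M) :
    letI := φ.reduct M
    (interpretationOfStructure num A d (num (.inr ⟨2, φ.onRelation Language.leSymb⟩))).SatVal 0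
      (formulaCode p) (List.ofFn e) ↔ p.Realize v e := by
  let := φ.reduct M
  have hvar : ∀ {n : ℕ} (t : Language.order.Term (Empty ⊕ Fin n)) (e : Fin n → M),
      t.realize (Sum.elim v e) = (List.ofFn e).getD (termCode t) d := by
    intro n t e
    match t with
    | .var (.inl i) => exact i.elim
    | .var (.inr i) => simp [termCode]
    | .func f _ => exact Empty.elim f
  refine iff_realize_of_tarski (π := id) (A := Set.univ) (code := fun {n} => formulaCode (n := n))
    (S := (interpretationOfStructure num A d _).SatVal 0) Function.surjective_id
    (fun e => Interpretation.satVal_falsum _ 0 e)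
    (fun p q e => Interpretation.satVal_impCode _ 0 _ _ e)
    (fun p e => Interpretation.satVal_allCode _ 0 _ e)
    (fun t s e _ _ => ?_) (fun {n l} R ts e _ => ?_) p e (Set.subset_univ _)
  · refine (Interpretation.satVal_order_eqCode _ _ _ _).trans ?_
    rw [Function.id_comp, hvar, hvar]
    rfl
  · rw [Function.id_comp]
    simp only [hvar]
    match l, R with
    | 2, .le =>
      refine (Interpretation.satVal_order_leCode _ _ _ _).trans ?_
      refine Iff.trans ?_ (rel_interpretation hA d
        (num (.inr ⟨2, φ.onRelation Language.leSymb⟩)) hφ _)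
      simp [List.ofFn_succ]
      rfl

end OfStructure

theorem exists_describesModel {K : FirstOrder.Language.{u, v}} {num : K.Symbols → ℕ}
    (φ : Language.order →ᴸ K) (τ : K.Sentence) (hnum : Set.InjOn num
      (insert (.inr ⟨2, φ.onRelation Language.leSymb⟩) (formulaSymbols τ)))
    (σ : Language.order.Sentence) (M : Type w) [K.Structure M] [Nonempty M] (hτ : M ⊨ τ)
    (hσ : ¬ M ⊨ φ.onSentence σ) :
    ∃ H, DescribesModel (num (.inr ⟨2, φ.onRelation Language.leSymb⟩)) (symFormulaCode num τ)
      (formulaCode σ) H := by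
  let := φ.reduct M
  obtain ⟨d⟩ := ‹Nonempty M›
  have h1 := satVal_interpretation hnum d (num (.inr ⟨2, φ.onRelation Language.leSymb⟩)) τ
    (Set.subset_insert _ _) (@default _ Unique.instInhabited) (@default _ Unique.instInhabited)
  have h2 := order_satVal_interpretation hnum d φ (Set.mem_insert _ _) σ
    (@default _ Unique.instInhabited) (@default _ Unique.instInhabited)
  rw [List.ofFn_zero] at h1 h2
  rw [Language.LHom.realize_onSentence] at hσ
  exact ⟨_, Interpretation.describesModel _ (h1.2 hτ) (mt h2.1 hσ)⟩

end YoungLattice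

namespace YoungLattice

/-! ### Undecidability and non-finite axiomatizability -/

/-- A recursive set of codes is recursively enumerable; injectivity of `formulaCode` ensures that a
sentence sharing its code with a true sentence is that sentence. -/
theorem not_decidableTheory_elementaryTheory : ¬ DecidableTheory elementaryTheory := by
  intro h
  refine not_rePred_of_iff_mem_elementaryTheory (fun σ => ⟨?_, fun hσ => ⟨σ, hσ, rfl⟩⟩) h.to_re
  rintro ⟨ρ, hρ, h⟩
  rwa [← formulaCode_injective _ _ h]

/-- The sentences of the language of orders that follow from a sentence of a larger language are
recursively enumerable. -/
theorem exists_rePred_iff_models {K : FirstOrder.Language.{u', v'}} (φ : Language.order →ᴸ K)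
    (τ : K.Sentence) : ∃ P : ℕ → Prop, REPred P ∧
      ∀ σ : Language.order.Sentence, P (formulaCode σ) ↔ {τ} ⊨ᵇ φ.onSentence σ := by
  have hfin : (insert (.inr ⟨2, φ.onRelation Language.leSymb⟩) (formulaSymbols τ)).Finite :=
    (finite_formulaSymbols τ).insert _
  -- The language may be uncountable, but only the finitely many symbols of τ and the symbol naming
  -- ≤ need distinct numbers.
  obtain ⟨num, hnum⟩ := Set.countable_iff_exists_injOn.1 hfin.countable
  refine ⟨_, rePred_unsatisfiable (primrec_modelClauses
    (num (.inr ⟨2, φ.onRelation Language.leSymb⟩)) (symFormulaCode num τ)), fun σ => ?_⟩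
  simp only [satisfies_modelClauses_iff]
  constructor
  · intro h
    rw [Language.Theory.models_sentence_iff]
    intro M
    by_contra hσ
    exact h (exists_describesModel φ τ hnum σ M (Language.Theory.model_singleton_iff.1 M.is_model)
      hσ)
  · rintro h ⟨H, hH⟩
    obtain ⟨Q, _, _, hτ, hσ⟩ := exists_model_of_describesModel num φ τ σ hH
    have : Q ⊨ ({τ} : K.Theory) := Language.Theory.model_singleton_iff.2 hτ
    exact hσ (h.realize_sentence Q)

theorem exists_sentence_of_finite {K : FirstOrder.Language.{u', v'}} {T : K.Theory}
    (hT : T.Finite) : ∃ τ : K.Sentence, ∀ (M : Type w) [K.Structure M], M ⊨ τ ↔ M ⊨ T := by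
  have := hT.to_subtype
  refine ⟨Language.BoundedFormula.iInf fun ψ : T => (ψ : K.Sentence), fun M _ => ?_⟩
  rw [Language.Theory.model_iff, Language.Sentence.Realize, Language.Formula.Realize,
    Language.BoundedFormula.realize_iInf]
  simp [Language.Sentence.Realize, Language.Formula.Realize]

/-- A consistent theory extending the elementary theory of Young's lattice is not finitely
axiomatizable. -/
theorem not_finitelyAxiomatizable_of_models {K : FirstOrder.Language.{u', v'}}
    (φ : Language.order →ᴸ K) {T : K.Theory} (hT : T.IsSatisfiable)
    (hφ : ∀ σ ∈ elementaryTheory, T ⊨ᵇ φ.onSentence σ) : ¬ FinitelyAxiomatizable T := by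
  rintro ⟨T₀, hfin, hT₀⟩
  obtain ⟨τ, hτ⟩ := exists_sentence_of_finite.{u', v', max u' v'} hfin
  have hmod : ∀ ψ : K.Sentence, {τ} ⊨ᵇ ψ ↔ T ⊨ᵇ ψ := by
    intro ψ
    rw [← hT₀, Language.Theory.models_sentence_iff, Language.Theory.models_sentence_iff]
    constructor
    · intro h M
      have : M ⊨ ({τ} : K.Theory) := Language.Theory.model_singleton_iff.2 ((hτ M).2 M.is_model)
      exact h (.of _ M)
    · intro h M
      have : M ⊨ T₀ := (hτ M).1 (Language.Theory.model_singleton_iff.1 M.is_model)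
      exact h (.of _ M)
  obtain ⟨P, hP, h⟩ := exists_rePred_iff_models φ τ
  refine not_rePred_of_iff_mem_elementaryTheory (fun σ => ?_) hP
  rw [h, hmod]
  refine ⟨fun hσ => ?_, hφ σ⟩
  -- Completeness of the elementary theory: if σ were false in Young's lattice, T would entail both
  -- σ and its negation, which no model of T allows.
  by_contra hn
  obtain ⟨M⟩ := hT
  have h1 := hφ (∼σ) (by
    rw [elementaryTheory, Language.mem_completeTheory] at hn ⊢
    rwa [Language.Sentence.realize_not])
  have h2 := h1.realize_sentence M
  rw [Language.LHom.onSentence, Language.LHom.onFormula] at h2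
  exact h2 (hσ.realize_sentence M)

end YoungLattice

theorem theorem3p13 :
    ¬ YoungLattice.DecidableTheory YoungLattice.elementaryTheory ∧
      YoungLattice.InherentlyNonFinitelyAxiomatizable.{0, 0, u', v'}
        YoungLattice.elementaryTheory := by
  refine ⟨YoungLattice.not_decidableTheory_elementaryTheory, ?_, fun K φ T =>
    YoungLattice.not_finitelyAxiomatizable_of_models φ⟩
  -- The theory itself is treated as its own extension along the identity of the language.
  refine YoungLattice.not_finitelyAxiomatizable_of_models (FirstOrder.Language.LHom.id _) ?_ ?_
  · exact FirstOrder.Language.completeTheory.isSatisfiable _ YoungDiagram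
  · intro σ hσ
    rw [FirstOrder.Language.LHom.onSentence, FirstOrder.Language.LHom.onFormula,
      FirstOrder.Language.LHom.id_onBoundedFormula]
    exact FirstOrder.Language.Theory.models_sentence_of_mem hσ
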